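/- **Setting.** A metric measure space $\mathcal X=(X,r,\rho,\mu)$ is a complete separable metric space $(X,r)$ with a root $\rho\in X$ and a Borel measure $\mu$ on $X$ that is finite on bounded sets. Write $X^{\circ}:=\operatorname{supp}(\mu)\cup\{\rho\}$ and $\iota(\mathcal X):=(X^{\circ},r,\rho,\mu)$; if $\rho\in\operatorname{supp}(\mu)$, then $X^{\circ}=\operatorname{supp}(\mu)$. Two spaces are *strongly equivalent* if there is a surjective isometry $X\to X'$ that maps $\rho$ to $\rho'$ and pushes $\mu$ forward to $\mu'$; they are *equivalent* if $\iota(\mathcal X)$ and $\iota(\mathcal X')$ are strongly equivalent. Let $\mathbb X_{\mathrm c}$ be the set of equivalence classes that contain a representative with $(X,r)$ compact, and let $\mathfrak X_{\mathrm c}^{\mathrm{supp}}$ be the set of strong equivalence classes of spaces with $(X,r)$ compact and $\operatorname{supp}(\mu)=X$. For $\delta>0$ let $m_\delta(\mathcal X):=\inf_{R>0}\inf\{\mu(\overline B(x,\delta)) : x\in \operatorname{supp}(\mu),\ r(\rho,x)<R\}\in[0,\infty]$, with $\inf\emptyset=\infty$ and $1/\infty=0$. Let $$d_{\mathrm{GHP}}(\mathcal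 X,\mathcal X'):=\inf_d\Big(d_{\mathrm{Pr}}^{d}(\mu,\mu')+d_{\mathrm H}^{d}(X,X')+d(\rho,\rho')\Big),$$ where $d$ runs over all metrics on the disjoint union $X\sqcup X'$ that extend $r$ and $r'$, and $d_{\mathrm{Pr}}^d$, $d_{\mathrm H}^d$ are the Prohorov and Hausdorff distances for $d$. The *support Gromov–Hausdorff–Prohorov distance* is $$d_{\mathrm{sGHP}}(\mathcal X,\mathcal X'):=d_{\mathrm{GHP}}(\iota(\mathcal X),\iota(\mathcal X'))+\int_0^1 1\wedge\Big|\frac1{m_\delta(\mathcal X)}-\frac1{m_\delta(\mathcal X')}\Big|\,d\delta .$$ A sequence $\mathcal X_n=(X_n,r_n,\rho_n,\mu_n)$ of spaces representing elements of $\mathbb X_{\mathrm c}$ converges *Gromov–Hausdorff-weakly* to such a space $\mathcal X_\infty$ if there are a pointed metric space $(E,d_E,\rho_E)$ and isometries (into) $\varphi_n\colon X_n^{\circ}\to E$, $n\in\mathbb N\cup\{\infty\}$, with $\varphi_n(\rho_n)=\rho_E$, such that $(\varphi_n)_*\mu_n$ converges weakly to $(\varphi_\infty)_*\mu_\infty$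 and the Hausdorff distance of $\varphi_n(\operatorname{supp}(\mu_n))$ and $\varphi_\infty(\operatorname{supp}(\mu_\infty))$ in $E$ tends to $0$ (the Hausdorff distance of $\emptyset$ from a non-empty set is $\infty$, and from $\emptyset$ it is $0$). The *Gromov–Hausdorff-weak topology* on $\mathbb X_{\mathrm c}$ is the one whose open sets $U$ are those for which every sequence converging Gromov–Hausdorff-weakly to a point of $U$ is eventually in $U$. **Proposition.** (1) $d_{\mathrm{sGHP}}$ is a well-defined, finite metric on $\mathbb X_{\mathrm c}$ that induces the Gromov–Hausdorff-weak topology; moreover a sequence in $\mathbb X_{\mathrm c}$ converges in $d_{\mathrm{sGHP}}$ if and only if it converges Gromov–Hausdorff-weakly, to the same limit. The metric space $(\mathbb X_{\mathrm c},d_{\mathrm{sGHP}})$ is complete and separable. The classes of spaces with $\rho\in\operatorname{supp}(\mu)$ form a closed subset of it (so that the same holds on this subset). (2) $d_{\mathrm{GHP}}$ is a well-defined, finite metric on $\mathfrak X_{\mathrm c}^{\mathrm{supp}}$, and $(\mathfrak X_{\mathrm c}^{\mathrm{supp}},d_{\mathrm{GHP}})$ is not complete, but its topology is Polish. -/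

import Mathlib

open MeasureTheory Set Filter Topology
open scoped ENNReal NNReal BoundedContinuousFunction

noncomputable section

namespace SupportGHP

/-- A pointed, complete, separable metric space with a Borel measure that is finite on bounded
sets. Every such space is isometric to one whose carrier lives in `Type`. -/
structure MMSpace where
  carrier : Type
  [metric : MetricSpace carrier]
  [complete : CompleteSpace carrier]
  [separable : TopologicalSpace.SeparableSpace carrier]
  [measurable : MeasurableSpace carrier]
  [borel : BorelSpace carrier]
  root : carrier
  μ : Measure carrier
  finite_of_isBounded : ∀ s : Set carrier, Bornology.IsBounded s → μ s < ⊤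

instance : CoeSort MMSpace Type := ⟨MMSpace.carrier⟩

attribute [instance] MMSpace.metric MMSpace.complete MMSpace.separable MMSpace.measurable
  MMSpace.borel

/-- The support of the measure together with the root; this is the support itself as soon as the
root belongs to it. -/
def MMSpace.coreSet (X : MMSpace) : Set X := X.μ.support ∪ {X.root}

theorem MMSpace.isClosed_coreSet (X : MMSpace) : IsClosed X.coreSet :=
  Measure.isClosed_support.union isClosed_singleton

/-- The space `(supp μ ∪ {ρ}, r, ρ, μ)`, with the restricted metric and the restricted measure. -/
def MMSpace.core (X : MMSpace) : MMSpace :=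
  haveI : SecondCountableTopology X := UniformSpace.secondCountable_of_separable X
  haveI : CompleteSpace X.coreSet := X.isClosed_coreSet.completeSpace_coe
  { carrier := X.coreSet
    root := ⟨X.root, Or.inr rfl⟩
    μ := X.μ.comap Subtype.val
    finite_of_isBounded := by
      intro s hs
      have hm : MeasurableSet X.coreSet := X.isClosed_coreSet.measurableSet
      rw [(MeasurableEmbedding.subtype_coe hm).comap_apply]
      exact X.finite_of_isBounded _ (isometry_subtype_coe.lipschitz.isBounded_image hs) }

/-- Strong equivalence: a surjective isometry of the whole spaces that preserves the root and the
measure. -/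
def StrongEquiv (X Y : MMSpace) : Prop :=
  ∃ φ : X ≃ᵢ Y, φ X.root = Y.root ∧ X.μ.map φ = Y.μ

theorem strongEquiv_equivalence : Equivalence StrongEquiv where
  refl X := ⟨IsometryEquiv.refl X, rfl, Measure.map_id⟩
  symm := by
    rintro X Y ⟨φ, h1, h2⟩
    refine ⟨φ.symm, ?_, ?_⟩
    · rw [← h1, φ.symm_apply_apply]
    · rw [← h2, Measure.map_map φ.symm.continuous.measurable φ.continuous.measurable]
      have h : (φ.symm : Y → X) ∘ φ = id := by
        funext x
        exact φ.symm_apply_apply x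
      rw [h, Measure.map_id]
  trans := by
    rintro X Y Z ⟨φ, h1, h2⟩ ⟨ψ, h3, h4⟩
    refine ⟨φ.trans ψ, ?_, ?_⟩
    · simp [h1, h3]
    · rw [← h4, ← h2, Measure.map_map ψ.continuous.measurable φ.continuous.measurable]
      rfl

def strongSetoid : Setoid MMSpace := ⟨StrongEquiv, strongEquiv_equivalence⟩

/-- Equivalence of metric measure spaces: a surjective isometry
`supp μ ∪ {ρ} → supp μ' ∪ {ρ'}` that preserves the root and the measure. -/
def mmSetoid : Setoid MMSpace := strongSetoid.comap MMSpace.core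

/-- Equivalence classes of metric boundedly finite measure spaces. -/
def MMClass : Type 1 := Quotient mmSetoid

def MMClass.mk (X : MMSpace) : MMClass := Quotient.mk mmSetoid X

/-- A class is compact if it contains a representative whose underlying space is compact. -/
def MMClass.IsCompact (x : MMClass) : Prop := ∃ X : MMSpace, MMClass.mk X = x ∧ CompactSpace X

/-- The set of (equivalence classes of) compact metric finite measure spaces. -/
def CompactMM : Type 1 := {x : MMClass // x.IsCompact}

def CompactMM.mk (X : MMSpace) (hX : (MMClass.mk X).IsCompact) : CompactMM := ⟨MMClass.mk X, hX⟩

/-- `inf {μ (B̄(x, δ)) : x ∈ B(ρ, R) ∩ supp μ}`, with `inf ∅ = ∞`. -/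
def localLowerMass (δ R : ℝ) (X : MMSpace) : ℝ≥0∞ :=
  ⨅ x ∈ Metric.ball X.root R ∩ X.μ.support, X.μ (Metric.closedBall x δ)

/-- The global lower mass function `m_δ`. -/
def lowerMass (δ : ℝ) (X : MMSpace) : ℝ≥0∞ :=
  ⨅ (R : ℝ) (_ : 0 < R), localLowerMass δ R X

/-- The Gromov-Hausdorff-Prohorov distance: the infimum, over all metrics on the disjoint union
that extend the two given ones, of Prohorov distance plus Hausdorff distance plus distance of the
roots. For each of these metrics both summands are open and closed in the disjoint union (they are
complete), so that the `σ`-algebra of the disjoint union is the Borel one. -/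
def ghpEDist (X Y : MMSpace) : ℝ≥0∞ :=
  ⨅ (_ : MetricSpace (X ⊕ Y)) (_ : Isometry (Sum.inl : X → X ⊕ Y))
    (_ : Isometry (Sum.inr : Y → X ⊕ Y)),
    levyProkhorovEDist (X.μ.map (Sum.inl : X → X ⊕ Y)) (Y.μ.map (Sum.inr : Y → X ⊕ Y))
      + Metric.hausdorffEDist (range (Sum.inl : X → X ⊕ Y)) (range (Sum.inr : Y → X ⊕ Y))
      + edist (Sum.inl X.root : X ⊕ Y) (Sum.inr Y.root)

/-- The support Gromov-Hausdorff-Prohorov distance. -/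
def sGHPEDist (X Y : MMSpace) : ℝ≥0∞ :=
  ghpEDist X.core Y.core
    + ∫⁻ δ in Icc (0 : ℝ) 1,
        min 1 (ENNReal.ofReal |(1 / lowerMass δ X).toReal - (1 / lowerMass δ Y).toReal|)

/-- Gromov-Hausdorff-weak convergence of metric finite measure spaces: there are a pointed metric
space `E` and root-preserving isometries `supp μ ∪ {ρ} → E` for all the spaces, such that the
push-forwards of the measures converge weakly and the images of the supports (without the root,
when it is not in the support) converge in Hausdorff distance. -/
def GHWConverges (X : ℕ → MMSpace) (X₀ : MMSpace) : Prop :=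
  ∃ (E : Type) (_ : MetricSpace E) (_ : MeasurableSpace E) (_ : BorelSpace E) (ρ : E)
    (φ : ∀ n, (X n).core → E) (φ₀ : X₀.core → E),
    (∀ n, Isometry (φ n) ∧ φ n (X n).core.root = ρ) ∧
    (Isometry φ₀ ∧ φ₀ X₀.core.root = ρ) ∧
    (∀ f : E →ᵇ ℝ≥0, Tendsto (fun n => ∫⁻ z, (f z : ℝ≥0∞) ∂((X n).core.μ.map (φ n))) atTop
      (𝓝 (∫⁻ z, (f z : ℝ≥0∞) ∂(X₀.core.μ.map φ₀)))) ∧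
    Tendsto (fun n => Metric.hausdorffEDist
        (φ n '' {z : (X n).coreSet | (z : X n) ∈ (X n).μ.support})
        (φ₀ '' {z : X₀.coreSet | (z : X₀) ∈ X₀.μ.support})) atTop (𝓝 0)

/-- The Gromov-Hausdorff-weak topology on compact metric measure spaces: a set is open if and only
if it eventually contains every sequence that converges Gromov-Hausdorff-weakly to one of its
points. -/
abbrev ghwTopology : TopologicalSpace CompactMM where
  IsOpen U := ∀ (X : ℕ → MMSpace) (X₀ : MMSpace) (hX : ∀ n, (MMClass.mk (X n)).IsCompact)
    (hX₀ : (MMClass.mk X₀).IsCompact), GHWConverges X X₀ →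
    CompactMM.mk X₀ hX₀ ∈ U →
    ∀ᶠ n in atTop, CompactMM.mk (X n) (hX n) ∈ U
  isOpen_univ := by
    intro X X₀ hX hX₀ _ _
    exact Eventually.of_forall fun _ => mem_univ _
  isOpen_inter := by
    intro U V hU hV X X₀ hX hX₀ h hmem
    exact (hU X X₀ hX hX₀ h hmem.1).and (hV X X₀ hX hX₀ h hmem.2)
  isOpen_sUnion := by
    intro S hS X X₀ hX hX₀ h hmem
    obtain ⟨U, hU, hmU⟩ := hmem
    exact (hS U hU X X₀ hX hX₀ h hmU).mono fun n hn => ⟨U, hU, hn⟩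

/-- Strong equivalence classes of metric measure spaces. -/
def StrongClass : Type 1 := Quotient strongSetoid

def StrongClass.mk (X : MMSpace) : StrongClass := Quotient.mk strongSetoid X

/-- A strong class of compact metric measure spaces whose measure has full support. -/
def StrongClass.IsCompactFullSupport (x : StrongClass) : Prop :=
  ∃ X : MMSpace, StrongClass.mk X = x ∧ CompactSpace X ∧ X.μ.support = univ

/-- The set of strong equivalence classes of compact metric measure spaces with full support. -/
def CompactFullSupport : Type 1 := {x : StrongClass // x.IsCompactFullSupport}

def CompactFullSupport.mk (X : MMSpace) (hX : (StrongClass.mk X).IsCompactFullSupport) :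
    CompactFullSupport := ⟨StrongClass.mk X, hX⟩

end SupportGHP

end

/-! A metric on `X ⊔ Y` that extends both metrics is determined by its cross distances `d x y`, so
the Gromov-Hausdorff-Prohorov distance is handled through such functions (`IsCoupling`,
`GHPWitness`). Adding a small constant turns a pseudometric into a metric, and `crossComp`, which
glues along a middle space, gives the triangle inequality. For compact spaces at distance zero, a
limit of approximate matchings is an isometry that preserves root and measure
(`strongEquiv_of_ghpEDist_eq_zero`).

This distance alone does not control supports: the mass near a point may fade away while the point
stays. The integral term prevents this. If it is below `δ / 2`, then `m_δ` of one space is bounded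
below in terms of `m_{δ/2}` of the other (`lowerMass_ge_of_lowerMassEDist_lt`), and once `m_δ`
exceeds the Prohorov distance, every support point lies near the other support
(`exists_support_lt`). Conversely, closeness of roots, supports and measures (`SClose`) makes the
lower mass functions converge wherever the limit is continuous, hence almost everywhere, and the
integral vanishes in the limit by dominated convergence. So convergence in the new distance means
`SClose` for every `ε` (`tendsto_sGHPEDist_iff`). This is Gromov-Hausdorff-weak convergence: weak
and Prohorov convergence agree here, and the couplings with the limit space can be glued along it
into one space, the roots having been identified (`ghwConverges_of_sClose`).

For completeness, a fast Cauchy sequence embeds into one compact space. Roots and measures have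
limits along an ultrafilter, and the uniform lower mass bounds make the supports close
(`exists_limit`). For separability, finitely supported spaces are dense and are described by
finitely many real numbers. A root in the support passes to limits, since it is a support point near
the limit support.

For full supports, a bound on the Gromov-Hausdorff-Prohorov distance already is `SClose`. Hence the
second space is homeomorphic to the closed set of classes with the root in the support, and is
Polish. Letting the mass of one of two points tend to zero shows that its metric is not complete. -/

noncomputable section

namespace SupportGHP

/-! ### Cross distances -/

section Coupling

variable {X Y Z : Type*} [MetricSpace X] [MetricSpace Y] [MetricSpace Z]

/-- The cross distances `d x y`, `x ∈ X`, `y ∈ Y`, of a pseudometric on `X ⊔ Y` that extends the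
metrics of `X` and of `Y`. -/
structure IsCoupling (d : X → Y → ℝ) : Prop where
  left : ∀ x x' y, d x y ≤ dist x x' + d x' y
  right : ∀ x y y', d x y ≤ d x y' + dist y' y
  left_le : ∀ x x' y, dist x x' ≤ d x y + d x' y
  right_le : ∀ x y y', dist y y' ≤ d x y + d x y'

namespace IsCoupling

variable {d : X → Y → ℝ} {d' : Y → Z → ℝ}

theorem nonneg (h : IsCoupling d) (x : X) (y : Y) : 0 ≤ d x y := by
  have := h.left_le x x y
  rw [dist_self] at this
  linarith

theorem flip (h : IsCoupling d) : IsCoupling (fun y x => d x y) where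
  left y y' x := by linarith [h.right x y y', dist_comm y y']
  right y x x' := by linarith [h.left x x' y, dist_comm x x']
  left_le y y' x := h.right_le x y y'
  right_le y x x' := h.left_le x x' y

theorem restrict (h : IsCoupling d) {X' Y' : Type*} [MetricSpace X'] [MetricSpace Y']
    {f : X' → X} {g : Y' → Y} (hf : Isometry f) (hg : Isometry g) :
    IsCoupling (fun x y => d (f x) (g y)) where
  left x x' y := by simpa [hf.dist_eq] using h.left (f x) (f x') (g y)
  right x y y' := by simpa [hg.dist_eq] using h.right (f x) (g y) (g y')
  left_le x x' y := by simpa [hf.dist_eq] using h.left_le (f x) (f x') (g y)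
  right_le x y y' := by simpa [hg.dist_eq] using h.right_le (f x) (g y) (g y')

theorem dist_self : IsCoupling (fun x y : X => dist x y) where
  left := dist_triangle
  right _ _ _ := dist_triangle _ _ _
  left_le := dist_triangle_right
  right_le _ _ _ := dist_triangle_left _ _ _

theorem of_isometry {f : X → Z} {g : Y → Z} (hf : Isometry f) (hg : Isometry g) :
    IsCoupling (fun x y => dist (f x) (g y)) :=
  dist_self.restrict hf hg

/-- With `c > 0` all cross distances become positive, as a metric on the disjoint union requires. -/
theorem add_const (h : IsCoupling d) {c : ℝ} (hc : 0 ≤ c) : IsCoupling (fun x y => d x y + c) where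
  left x x' y := by linarith [h.left x x' y]
  right x y y' := by linarith [h.right x y y']
  left_le x x' y := by linarith [h.left_le x x' y]
  right_le x y y' := by linarith [h.right_le x y y']

/-- Makes the neighbourhoods in `LPLe` measurable, so that the condition can be applied to them in
turn. -/
theorem isOpen_left (h : IsCoupling d) (A : Set X) (a : ℝ) :
    IsOpen {y | ∃ x ∈ A, d x y < a} := by
  rw [Metric.isOpen_iff]
  rintro y ⟨x, hx, hxy⟩
  refine ⟨a - d x y, by linarith, fun y' hy' => ⟨x, hx, ?_⟩⟩
  rw [Metric.mem_ball, dist_comm] at hy'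
  linarith [h.right x y' y]

/-- Points at finite distance through given base points only. -/
theorem through (x₀ : X) (y₀ : Y) : IsCoupling (fun x y => dist x x₀ + dist y₀ y) where
  left x x' y := by linarith [dist_triangle x x' x₀]
  right x y y' := by linarith [dist_triangle y₀ y' y]
  left_le x x' y := by linarith [dist_triangle_right x x' x₀, dist_nonneg (x := y₀) (y := y)]
  right_le x y y' := by linarith [dist_triangle_left y y' y₀, dist_nonneg (x := x) (y := x₀)]

/-- Shortening a cross distance so that two nearby base points become identified. -/
theorem identify (h : IsCoupling d) {x₀ : X} {y₀ : Y} {c : ℝ} (hc : d x₀ y₀ ≤ c) :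
    IsCoupling (fun x y => min (d x y + c) (dist x x₀ + dist y₀ y)) := by
  have hc0 : 0 ≤ c := (h.nonneg _ _).trans hc
  have h1 := h.add_const hc0
  have h2 := through x₀ y₀
  refine ⟨fun x x' y => ?_, fun x y y' => ?_, fun x x' y => ?_, fun x y y' => ?_⟩
  · rw [← min_add_add_left]
    exact min_le_min (h1.left x x' y) (h2.left x x' y)
  · rw [← min_add_add_right]
    exact min_le_min (h1.right x y y') (h2.right x y y')
  · rcases min_choice (d x y + c) (dist x x₀ + dist y₀ y) with e | e <;>
    rcases min_choice (d x' y + c) (dist x' x₀ + dist y₀ y) with e' | e' <;> simp only [e, e']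
    · exact h1.left_le x x' y
    -- Mixed case: the detour through `x₀` works because `dist x x₀ ≤ d x y₀ + d x₀ y₀` and `d x₀ y₀
    -- ≤ c`.
    · linarith [h.left_le x x₀ y₀, h.right x y₀ y, h.left_le x x₀ y, h.right x₀ y y₀,
        dist_triangle_right x x' x₀, dist_comm y₀ y]
    · linarith [h.left_le x' x₀ y, h.right x₀ y y₀,
        dist_triangle_right x x' x₀, dist_comm y₀ y]
    · exact h2.left_le x x' y
  · rcases min_choice (d x y + c) (dist x x₀ + dist y₀ y) with e | e <;>
    rcases min_choice (d x y' + c) (dist x x₀ + dist y₀ y') with e' | e' <;> simp only [e, e']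
    · exact h1.right_le x y y'
    · linarith [h.right_le x₀ y y₀, h.left x₀ x y, dist_triangle y y₀ y', dist_comm x x₀]
    · linarith [h.right_le x₀ y' y₀, h.left x₀ x y', dist_triangle y y₀ y', dist_comm x x₀,
        dist_comm y y₀, dist_comm y' y₀]
    · exact h2.right_le x y y'

end IsCoupling

/-- Composition of cross distances: gluing along the space in the middle. -/
def crossComp (d : X → Y → ℝ) (d' : Y → Z → ℝ) (x : X) (z : Z) : ℝ := ⨅ y, d x y + d' y z

section comp

variable {d : X → Y → ℝ} {d' : Y → Z → ℝ}

theorem crossComp_le (h : IsCoupling d) (h' : IsCoupling d') (x : X) (y : Y) (z : Z) :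
    crossComp d d' x z ≤ d x y + d' y z :=
  ciInf_le ⟨0, by rintro _ ⟨y, rfl⟩; exact add_nonneg (h.nonneg _ _) (h'.nonneg _ _)⟩ y

theorem IsCoupling.comp [Nonempty Y] (h : IsCoupling d) (h' : IsCoupling d') :
    IsCoupling (crossComp d d') where
  left x x' z := by
    rw [← sub_le_iff_le_add']
    refine le_ciInf fun y => ?_
    linarith [crossComp_le h h' x y z, h.left x x' y]
  right x z z' := by
    rw [← sub_le_iff_le_add]
    refine le_ciInf fun y => ?_
    linarith [crossComp_le h h' x y z, h'.right y z z']
  left_le x x' z := by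
    rw [← sub_le_iff_le_add]
    refine le_ciInf fun y => ?_
    rw [sub_le_comm]
    refine le_ciInf fun y' => ?_
    -- The two infima are approached at different middle points; `dist y y'` is paid for by the
    -- cross distances to `z`.
    linarith [h.left_le x x' y, h.right x' y y', h'.left_le y y' z, dist_comm y y']
  right_le x z z' := by
    rw [← sub_le_iff_le_add]
    refine le_ciInf fun y => ?_
    rw [sub_le_comm]
    refine le_ciInf fun y' => ?_
    linarith [h.right_le x y y', h'.left y y' z', h'.right_le y z z', dist_comm y y']

end comp

/-- The pseudometric on the disjoint union with given cross distances. -/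
@[reducible]
def sumPseudoMetric (d : X → Y → ℝ) (h : IsCoupling d) : PseudoMetricSpace (X ⊕ Y) where
  dist p q := match p, q with
    | .inl x, .inl x' => dist x x'
    | .inl x, .inr y => d x y
    | .inr y, .inl x => d x y
    | .inr y, .inr y' => dist y y'
  dist_self p := by rcases p with x | y <;> simp
  dist_comm p q := by rcases p with x | y <;> rcases q with x' | y' <;> simp [dist_comm]
  dist_triangle p q r := by
    rcases p with x | y <;> rcases q with x' | y' <;> rcases r with x'' | y'' <;>
      dsimp only
    · exact dist_triangle _ _ _
    · exact h.left _ _ _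
    · exact h.left_le _ _ _
    · exact h.right _ _ _
    · linarith [h.left x'' x' y, dist_comm x'' x']
    · exact h.right_le _ _ _
    · linarith [h.right x'' y y', dist_comm y y']
    · exact dist_triangle _ _ _

/-- The metric on the disjoint union with given positive cross distances. -/
@[reducible]
def sumMetric (d : X → Y → ℝ) (h : IsCoupling d) (hpos : ∀ x y, 0 < d x y) :
    MetricSpace (X ⊕ Y) :=
  { sumPseudoMetric d h with
    eq_of_dist_eq_zero := by
      rintro (x | y) (x' | y') hxy
      · exact congrArg _ (dist_eq_zero.1 hxy)
      · exact absurd hxy (hpos x y').ne'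
      · exact absurd hxy (hpos x' y).ne'
      · exact congrArg _ (dist_eq_zero.1 hxy) }

end Coupling

/-- Cross distances may vanish. The separation quotient then identifies points of `X` with points of
`Y`, and both embeddings stay isometric. -/
theorem IsCoupling.exists_isometry {X Y : Type} [MetricSpace X] [MetricSpace Y] {d : X → Y → ℝ}
    (h : IsCoupling d) : ∃ (B : Type) (_ : MetricSpace B) (f : X → B) (g : Y → B),
      Isometry f ∧ Isometry g ∧ ∀ x y, dist (f x) (g y) = d x y := by
  let := sumPseudoMetric d h
  let : UniformSpace (X ⊕ Y) := (sumPseudoMetric d h).toUniformSpace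
  let : TopologicalSpace (X ⊕ Y) := UniformSpace.toTopologicalSpace
  refine ⟨SeparationQuotient (X ⊕ Y), inferInstance, fun x => SeparationQuotient.mk (.inl x),
    fun y => SeparationQuotient.mk (.inr y), ?_, ?_, ?_⟩
  · exact Isometry.of_dist_eq fun x x' => SeparationQuotient.dist_mk _ _
  · exact Isometry.of_dist_eq fun x x' => SeparationQuotient.dist_mk _ _
  · exact fun x y => SeparationQuotient.dist_mk _ _

/-! ### One-sided Lévy-Prokhorov bounds -/

section LPLe

variable {X Y Z : Type*} [MeasurableSpace X] [MeasurableSpace Y] [MeasurableSpace Z]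

/-- One half of the Lévy-Prokhorov condition for the cross distance `d`. -/
def LPLe (d : X → Y → ℝ) (μ : Measure X) (ν : Measure Y) (a : ℝ) : Prop :=
  ∀ A, MeasurableSet A → μ A ≤ ν {y | ∃ x ∈ A, d x y < a} + ENNReal.ofReal a

variable {d : X → Y → ℝ} {d' : Y → Z → ℝ} {μ : Measure X} {ν : Measure Y} {κ : Measure Z}

theorem LPLe.mono_dist {e : X → Y → ℝ} {a b : ℝ} (h : LPLe d μ ν a) (hab : a ≤ b)
    (he : ∀ x y, d x y < a → e x y < b) : LPLe e μ ν b := fun A hA =>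
  (h A hA).trans (add_le_add (measure_mono fun _ ⟨x, hx, hxy⟩ => ⟨x, hx, he _ _ hxy⟩)
    (ENNReal.ofReal_le_ofReal hab))

theorem LPLe.mono {a b : ℝ} (h : LPLe d μ ν a) (hab : a ≤ b) : LPLe d μ ν b :=
  h.mono_dist hab fun _ _ h => h.trans_le hab

theorem LPLe.measure_univ_le {a : ℝ} (h : LPLe d μ ν a) :
    μ univ ≤ ν univ + ENNReal.ofReal a :=
  (h univ .univ).trans (by gcongr; exact subset_univ _)

variable [MetricSpace X] [MetricSpace Y] [MetricSpace Z]

/-- The `b`-neighbourhood of the `a`-neighbourhood of `A` lies in the `(a + b)`-neighbourhood for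
the composed cross distance. -/
theorem LPLe.comp [OpensMeasurableSpace Y] {a b : ℝ} (hd : IsCoupling d) (hd' : IsCoupling d')
    (ha : 0 ≤ a) (hb : 0 ≤ b) (h : LPLe d μ ν a) (h' : LPLe d' ν κ b) :
    LPLe (crossComp d d') μ κ (a + b) := by
  intro A hA
  refine (h A hA).trans ?_
  rw [ENNReal.ofReal_add ha hb, add_comm (ENNReal.ofReal a), ← add_assoc]
  gcongr
  refine (h' _ (hd.isOpen_left A a).measurableSet).trans ?_
  gcongr
  rintro ⟨y, ⟨x, hx, hxy⟩, hyz⟩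
  exact ⟨x, hx, (crossComp_le hd hd' x y _).trans_lt (add_lt_add hxy hyz)⟩

/-- For finite measures of almost equal mass, one half of the Lévy-Prokhorov condition implies
the other one. -/
theorem LPLe.flip [OpensMeasurableSpace X] [OpensMeasurableSpace Y] [IsFiniteMeasure μ]
    [IsFiniteMeasure ν]
    (hd : IsCoupling d) {a b : ℝ} (ha : 0 ≤ a) (hb : 0 ≤ b) (h : LPLe d μ ν a)
    (hm : ν univ ≤ μ univ + ENNReal.ofReal b) : LPLe (fun y x => d x y) ν μ (a + b) := by
  intro B hB
  set U : Set X := {x | ∃ y ∈ B, d x y < a + b} with hU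
  have hUo : MeasurableSet U := (hd.flip.isOpen_left B (a + b)).measurableSet
  -- No point within `a` of the complement of `U` lies in `B`. Comparison with the total masses then
  -- turns this bound into the one for `B`.
  have h1 : μ Uᶜ ≤ ν Bᶜ + ENNReal.ofReal a := by
    refine (h Uᶜ hUo.compl).trans ?_
    gcongr
    rintro y ⟨x, hx, hxy⟩ hy
    exact hx ⟨_, hy, by linarith⟩
  have h2 : ν B + ν Bᶜ ≤ μ U + ENNReal.ofReal (a + b) + ν Bᶜ := by
    rw [measure_add_measure_compl hB, ENNReal.ofReal_add ha hb]
    calc ν univ ≤ μ univ + ENNReal.ofReal b := hm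
      _ = μ U + μ Uᶜ + ENNReal.ofReal b := by rw [measure_add_measure_compl hUo]
      _ ≤ μ U + (ν Bᶜ + ENNReal.ofReal a) + ENNReal.ofReal b := by gcongr
      _ = _ := by ring
  exact (ENNReal.add_le_add_iff_right (measure_ne_top ν _)).1 h2

end LPLe


/-! ### The Gromov-Hausdorff-Prohorov distance through cross distances -/

/-- The cross distance `d` witnesses that the Prohorov distance, the Hausdorff distance and the
distance of the roots are at most `a`, `b` and `c`. -/
structure GHPWitness (X Y : MMSpace) (d : X → Y → ℝ) (a b c : ℝ) : Prop where
  coupling : IsCoupling d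
  -- `b` and `c` are positive automatically, being strict bounds of non-negative numbers; for zero
  -- measures `lp` and `lp'` would allow a negative `a`.
  pos : 0 < a
  lp : LPLe d X.μ Y.μ a
  lp' : LPLe (fun y x => d x y) Y.μ X.μ a
  left : ∀ x, ∃ y, d x y < b
  right : ∀ y, ∃ x, d x y < b
  root : d X.root Y.root < c

instance (X : MMSpace) : Nonempty X := ⟨X.root⟩

theorem GHPWitness.flip {X Y : MMSpace} {d : X → Y → ℝ} {a b c : ℝ} (h : GHPWitness X Y d a b c) :
    GHPWitness Y X (fun y x => d x y) a b c :=
  ⟨h.coupling.flip, h.pos, h.lp', h.lp, h.right, h.left, h.root⟩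

theorem GHPWitness.comp {X Y Z : MMSpace} {d : X → Y → ℝ} {d' : Y → Z → ℝ} {a b c a' b' c' : ℝ}
    (h : GHPWitness X Y d a b c) (h' : GHPWitness Y Z d' a' b' c') :
    GHPWitness X Z (crossComp d d') (a + a') (b + b') (c + c') where
  coupling := h.coupling.comp h'.coupling
  pos := add_pos h.pos h'.pos
  lp := h.lp.comp h.coupling h'.coupling h.pos.le h'.pos.le h'.lp
  lp' := by
    have := h'.lp'.comp h'.coupling.flip h.coupling.flip h'.pos.le h.pos.le h.lp'
    refine this.mono_dist (add_comm _ _).le fun z x hzx => ?_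
    rw [add_comm a a']
    simpa only [crossComp, add_comm] using hzx
  left x := by
    obtain ⟨y, hy⟩ := h.left x
    obtain ⟨z, hz⟩ := h'.left y
    exact ⟨z, (crossComp_le h.coupling h'.coupling x y z).trans_lt (add_lt_add hy hz)⟩
  right z := by
    obtain ⟨y, hy⟩ := h'.right z
    obtain ⟨x, hx⟩ := h.right y
    exact ⟨x, (crossComp_le h.coupling h'.coupling x y z).trans_lt (add_lt_add hx hy)⟩
  root := (crossComp_le h.coupling h'.coupling _ _ _).trans_lt (add_lt_add h.root h'.root)

section SumMeasure

variable {X Y : Type} [MetricSpace X] [MetricSpace Y] [MeasurableSpace X] [MeasurableSpace Y]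
  [BorelSpace X] [BorelSpace Y] {μ : Measure X} {ν : Measure Y}

theorem _root_.Isometry.measurableSet_preimage_thickening {E : Type*} [MetricSpace E] {f : X → E}
    (hf : Isometry f) (a : ℝ) (s : Set E) : MeasurableSet (f ⁻¹' Metric.thickening a s) :=
  (Metric.isOpen_thickening.preimage hf.continuous).measurableSet

/-- The `σ`-algebra is that of the disjoint union, so measurability is tested on the two summands.
-/
theorem measurableSet_sum_thickening [MetricSpace (X ⊕ Y)] (hl : Isometry (Sum.inl : X → X ⊕ Y))
    (hr : Isometry (Sum.inr : Y → X ⊕ Y)) (a : ℝ) (s : Set (X ⊕ Y)) :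
    MeasurableSet (Metric.thickening a s) :=
  measurableSet_sum_iff.2 ⟨hl.measurableSet_preimage_thickening a s,
    hr.measurableSet_preimage_thickening a s⟩

theorem LPLe.of_levyProkhorovEDist_lt [MetricSpace (X ⊕ Y)]
    (hl : Isometry (Sum.inl : X → X ⊕ Y)) (hr : Isometry (Sum.inr : Y → X ⊕ Y)) {a : ℝ}
    (ha : 0 ≤ a)
    (h : levyProkhorovEDist (μ.map (Sum.inl : X → X ⊕ Y)) (ν.map (Sum.inr : Y → X ⊕ Y)) <
      ENNReal.ofReal a) :
    LPLe (fun (x : X) (y : Y) => dist (Sum.inl x : X ⊕ Y) (Sum.inr y)) μ ν a ∧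
    LPLe (fun (y : Y) (x : X) => dist (Sum.inl x : X ⊕ Y) (Sum.inr y)) ν μ a := by
  constructor <;> intro A hA
  · have := left_measure_le_of_levyProkhorovEDist_lt h hA.inl_image
    rw [ENNReal.toReal_ofReal ha, Measure.map_apply measurable_inl hA.inl_image,
      preimage_image_eq _ Sum.inl_injective, Measure.map_apply measurable_inr
        (measurableSet_sum_thickening hl hr a _)] at this
    refine this.trans ?_
    gcongr
    intro y hy
    rw [mem_preimage, Metric.mem_thickening_iff] at hy
    obtain ⟨_, ⟨x, hx, rfl⟩, hxy⟩ := hy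
    exact ⟨x, hx, (dist_comm _ _).trans_lt hxy⟩
  · have := right_measure_le_of_levyProkhorovEDist_lt h hA.inr_image
    rw [ENNReal.toReal_ofReal ha, Measure.map_apply measurable_inr hA.inr_image,
      preimage_image_eq _ Sum.inr_injective, Measure.map_apply measurable_inl
        (measurableSet_sum_thickening hl hr a _)] at this
    refine this.trans ?_
    gcongr
    intro y hy
    rw [mem_preimage, Metric.mem_thickening_iff] at hy
    obtain ⟨_, ⟨x, hx, rfl⟩, hxy⟩ := hy
    exact ⟨x, hx, hxy⟩

end SumMeasure

theorem levyProkhorovEDist_le_of_LPLe {X Y : Type} [MeasurableSpace X] [MeasurableSpace Y]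
    {μ : Measure X} {ν : Measure Y} [MetricSpace (X ⊕ Y)] {a : ℝ} (ha : 0 ≤ a)
    (h : LPLe (fun (x : X) (y : Y) => dist (Sum.inl x : X ⊕ Y) (Sum.inr y)) μ ν a)
    (h' : LPLe (fun (y : Y) (x : X) => dist (Sum.inl x : X ⊕ Y) (Sum.inr y)) ν μ a) :
    levyProkhorovEDist (μ.map (Sum.inl : X → X ⊕ Y)) (ν.map (Sum.inr : Y → X ⊕ Y)) ≤
      ENNReal.ofReal a := by
  refine sInf_le fun B hB => ⟨?_, ?_⟩ <;> rw [ENNReal.toReal_ofReal ha]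
  · rw [Measure.map_apply measurable_inl hB]
    refine (h _ (measurable_inl hB)).trans ?_
    gcongr
    refine le_trans (measure_mono ?_) (Measure.le_map_apply measurable_inr.aemeasurable _)
    rintro y ⟨x, hx, hxy⟩
    exact Metric.mem_thickening_iff.2 ⟨_, hx, by rwa [dist_comm]⟩
  · rw [Measure.map_apply measurable_inr hB]
    refine (h' _ (measurable_inr hB)).trans ?_
    gcongr
    refine le_trans (measure_mono ?_) (Measure.le_map_apply measurable_inl.aemeasurable _)
    rintro y ⟨x, hx, hxy⟩
    exact Metric.mem_thickening_iff.2 ⟨_, hx, hxy⟩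

theorem exists_ghpWitness_of_lt {X Y : MMSpace} {t : ℝ} (h : ghpEDist X Y < ENNReal.ofReal t) :
    ∃ d a b c, GHPWitness X Y d a b c ∧ a + b + c < t := by
  simp only [ghpEDist, iInf_lt_iff] at h
  obtain ⟨m, hl, hr, h⟩ := h
  set A := levyProkhorovEDist (X.μ.map (Sum.inl : X → X ⊕ Y)) (Y.μ.map (Sum.inr : Y → X ⊕ Y))
    with hA
  set B := Metric.hausdorffEDist (range (Sum.inl : X → X ⊕ Y)) (range (Sum.inr : Y → X ⊕ Y))
    with hB
  have htop := h.ne_top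
  rw [edist_dist] at htop h
  set r := dist (Sum.inl X.root : X ⊕ Y) (Sum.inr Y.root)
  have hAt : A ≠ ⊤ := fun e => by simp [e] at htop
  have hBt : B ≠ ⊤ := fun e => by simp [e] at htop
  rw [← ENNReal.ofReal_toReal hAt, ← ENNReal.ofReal_toReal hBt, ← ENNReal.ofReal_add
    ENNReal.toReal_nonneg ENNReal.toReal_nonneg, ← ENNReal.ofReal_add (by positivity) dist_nonneg,
    ENNReal.ofReal_lt_ofReal_iff'] at h
  -- A quarter of the slack `s` goes to each of the three terms, which makes the bounds strict and
  -- keeps their sum below `t`.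
  obtain ⟨s, hs⟩ : ∃ s, s = t - (A.toReal + B.toReal + r) := ⟨_, rfl⟩
  have hs0 : 0 < s := by linarith [h.1]
  have hA0 : 0 ≤ A.toReal := ENNReal.toReal_nonneg
  have hB0 : 0 ≤ B.toReal := ENNReal.toReal_nonneg
  have hAlt : A < ENNReal.ofReal (A.toReal + s / 4) :=
    (ENNReal.lt_ofReal_iff_toReal_lt hAt).2 (by linarith)
  have hBlt : B < ENNReal.ofReal (B.toReal + s / 4) :=
    (ENNReal.lt_ofReal_iff_toReal_lt hBt).2 (by linarith)
  obtain ⟨hlp, hlp'⟩ := LPLe.of_levyProkhorovEDist_lt hl hr (by linarith) hAlt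
  refine ⟨_, _, B.toReal + s / 4, r + s / 4,
    ⟨IsCoupling.of_isometry hl hr, by linarith, hlp, hlp', fun x => ?_, fun y => ?_, by linarith⟩,
    by linarith⟩
  · obtain ⟨_, ⟨y, rfl⟩, hy⟩ :=
      Metric.exists_edist_lt_of_hausdorffEDist_lt (mem_range_self x) hBlt
    exact ⟨y, by rwa [edist_dist, ENNReal.ofReal_lt_ofReal_iff (by linarith)] at hy⟩
  · obtain ⟨_, ⟨x, rfl⟩, hx⟩ := Metric.exists_edist_lt_of_hausdorffEDist_lt (mem_range_self y)
      (Metric.hausdorffEDist_comm.trans_lt hBlt)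
    exact ⟨x, by rwa [edist_dist, dist_comm, ENNReal.ofReal_lt_ofReal_iff (by linarith)] at hx⟩

theorem GHPWitness.ghpEDist_lt {X Y : MMSpace} {d : X → Y → ℝ} {a b c t : ℝ}
    (h : GHPWitness X Y d a b c) (ht : a + b + c < t) : ghpEDist X Y < ENNReal.ofReal t := by
  -- The metric `d + η` raises each of the three bounds by `η`, and `3 * η` is less than the slack
  -- `4 * η`.
  obtain ⟨η, hη⟩ : ∃ η, η = (t - (a + b + c)) / 4 := ⟨_, rfl⟩
  have hη0 : 0 < η := by linarith
  have hb : 0 < b := by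
    obtain ⟨y, hy⟩ := h.left X.root
    exact (h.coupling.nonneg _ _).trans_lt hy
  have hc : 0 < c := (h.coupling.nonneg _ _).trans_lt h.root
  have ha := h.pos
  have hpos : ∀ x y, 0 < d x y + η := fun x y => by linarith [h.coupling.nonneg x y]
  let m := sumMetric _ (h.coupling.add_const hη0.le) hpos
  have hl : Isometry (Sum.inl : X → X ⊕ Y) := Isometry.of_dist_eq fun _ _ => rfl
  have hr : Isometry (Sum.inr : Y → X ⊕ Y) := Isometry.of_dist_eq fun _ _ => rfl
  have hd : ∀ x y, dist (Sum.inl x : X ⊕ Y) (Sum.inr y) = d x y + η := fun x y => rfl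
  refine (iInf_le_of_le m (iInf_le_of_le hl (iInf_le_of_le hr le_rfl))).trans_lt ?_
  have h1 : levyProkhorovEDist (X.μ.map (Sum.inl : X → X ⊕ Y)) (Y.μ.map (Sum.inr : Y → X ⊕ Y)) ≤
      ENNReal.ofReal (a + η) := by
    refine levyProkhorovEDist_le_of_LPLe (by linarith)
      (h.lp.mono_dist (by linarith) fun x y hxy => ?_)
      (h.lp'.mono_dist (by linarith) fun y x hxy => ?_) <;>
    · rw [hd]
      linarith
  have h2 : Metric.hausdorffEDist (range (Sum.inl : X → X ⊕ Y)) (range (Sum.inr : Y → X ⊕ Y)) ≤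
      ENNReal.ofReal (b + η) := by
    refine Metric.hausdorffEDist_le_of_mem_edist ?_ ?_
    · rintro _ ⟨x, rfl⟩
      obtain ⟨y, hy⟩ := h.left x
      refine ⟨_, ⟨y, rfl⟩, ?_⟩
      rw [edist_dist, hd]
      exact ENNReal.ofReal_le_ofReal (by linarith)
    · rintro _ ⟨y, rfl⟩
      obtain ⟨x, hx⟩ := h.right y
      refine ⟨_, ⟨x, rfl⟩, ?_⟩
      rw [edist_dist, dist_comm, hd]
      exact ENNReal.ofReal_le_ofReal (by linarith)
  have h3 : edist (Sum.inl X.root : X ⊕ Y) (Sum.inr Y.root) ≤ ENNReal.ofReal (c + η) := by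
    rw [edist_dist, hd]
    exact ENNReal.ofReal_le_ofReal (by linarith [h.root])
  refine (add_le_add (add_le_add h1 h2) h3).trans_lt ?_
  rw [← ENNReal.ofReal_add (by linarith) (by linarith), ← ENNReal.ofReal_add (by linarith)
    (by linarith), ENNReal.ofReal_lt_ofReal_iff (by linarith)]
  linarith

theorem le_of_forall_lt_ofReal {a b : ℝ≥0∞}
    (h : ∀ t : ℝ, b < ENNReal.ofReal t → a < ENNReal.ofReal t) : a ≤ b := by
  refine le_of_forall_gt_imp_ge_of_dense fun c hc => ?_
  rcases eq_or_ne c ⊤ with rfl | hct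
  · exact le_top
  · rw [← ENNReal.ofReal_toReal hct] at hc ⊢
    exact (h _ hc).le

theorem ghpEDist_comm (X Y : MMSpace) : ghpEDist X Y = ghpEDist Y X := by
  have key : ∀ X Y, ghpEDist X Y ≤ ghpEDist Y X := fun X Y => le_of_forall_lt_ofReal fun t ht => by
    obtain ⟨d, a, b, c, h, hlt⟩ := exists_ghpWitness_of_lt ht
    exact h.flip.ghpEDist_lt hlt
  exact le_antisymm (key _ _) (key _ _)

theorem ghpEDist_triangle (X Y Z : MMSpace) : ghpEDist X Z ≤ ghpEDist X Y + ghpEDist Y Z := by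
  rcases eq_or_ne (ghpEDist X Y) ⊤ with e | hXY
  · simp [e]
  rcases eq_or_ne (ghpEDist Y Z) ⊤ with e | hYZ
  · simp [e]
  refine ENNReal.le_of_forall_pos_le_add fun ε hε _ => ?_
  have hε' : (0 : ℝ) < ε := hε
  have h1 : ghpEDist X Y < ENNReal.ofReal ((ghpEDist X Y).toReal + ε / 2) :=
    (ENNReal.lt_ofReal_iff_toReal_lt hXY).2 (by linarith)
  have h2 : ghpEDist Y Z < ENNReal.ofReal ((ghpEDist Y Z).toReal + ε / 2) :=
    (ENNReal.lt_ofReal_iff_toReal_lt hYZ).2 (by linarith)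
  obtain ⟨d, a, b, c, h, hlt⟩ := exists_ghpWitness_of_lt h1
  obtain ⟨d', a', b', c', h', hlt'⟩ := exists_ghpWitness_of_lt h2
  refine ((h.comp h').ghpEDist_lt (t := (ghpEDist X Y).toReal + (ghpEDist Y Z).toReal + ε)
    (by linarith)).le.trans_eq ?_
  rw [ENNReal.ofReal_add (by positivity) hε'.le, ENNReal.ofReal_add (by positivity) (by positivity),
    ENNReal.ofReal_toReal hXY, ENNReal.ofReal_toReal hYZ, ENNReal.ofReal_coe_nnreal]

/-- Both spaces are joined at their roots. The Prohorov conditions are void as soon as `a` exceeds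
both total masses. -/
theorem ghpEDist_lt_top (X Y : MMSpace) [CompactSpace X] [CompactSpace Y] :
    ghpEDist X Y < ⊤ := by
  obtain ⟨M, hM⟩ := (Metric.isBounded_of_compactSpace (s := (univ : Set X))).subset_closedBall X.root
  obtain ⟨N, hN⟩ := (Metric.isBounded_of_compactSpace (s := (univ : Set Y))).subset_closedBall Y.root
  have hM0 : 0 ≤ M := dist_nonneg.trans (hM (mem_univ X.root))
  have hN0 : 0 ≤ N := dist_nonneg.trans (hN (mem_univ Y.root))
  have hXf := X.finite_of_isBounded univ Metric.isBounded_of_compactSpace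
  have hYf := Y.finite_of_isBounded univ Metric.isBounded_of_compactSpace
  have hlt : ∀ x y, dist x X.root + dist Y.root y < M + N + 1 := fun x y => by
    have h1 : dist x X.root ≤ M := hM (mem_univ x)
    have h2 : dist y Y.root ≤ N := hN (mem_univ y)
    rw [dist_comm] at h2
    linarith
  have hw : GHPWitness X Y (fun x y => dist x X.root + dist Y.root y)
      ((X.μ univ).toReal + (Y.μ univ).toReal + 1) (M + N + 1) (M + N + 1) := by
    refine ⟨IsCoupling.through _ _, by positivity, fun A _ => ?_, fun A _ => ?_,
      fun x => ⟨Y.root, hlt _ _⟩, fun y => ⟨X.root, hlt _ _⟩, hlt _ _⟩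
    · refine le_add_left ((measure_mono (subset_univ A)).trans ?_)
      rw [ENNReal.le_ofReal_iff_toReal_le hXf.ne (by positivity)]
      linarith [ENNReal.toReal_nonneg (a := Y.μ univ)]
    · refine le_add_left ((measure_mono (subset_univ A)).trans ?_)
      rw [ENNReal.le_ofReal_iff_toReal_le hYf.ne (by positivity)]
      linarith [ENNReal.toReal_nonneg (a := X.μ univ)]
  exact (hw.ghpEDist_lt (lt_add_one _)).trans ENNReal.ofReal_lt_top

theorem StrongEquiv.ghpEDist_eq_zero {X Y : MMSpace} (h : StrongEquiv X Y) : ghpEDist X Y = 0 := by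
  obtain ⟨φ, hroot, hμ⟩ := h
  refine le_antisymm (le_of_forall_lt_ofReal fun t ht => ?_) bot_le
  have ht0 : 0 < t := ENNReal.ofReal_pos.1 ht
  have hm : Measurable φ := φ.continuous.measurable
  refine GHPWitness.ghpEDist_lt (d := fun x y => dist (φ x) (id y)) (a := t / 4) (b := t / 4)
    (c := t / 4) ⟨IsCoupling.of_isometry φ.isometry isometry_id, by linarith, fun A hA => ?_,
      fun A hA => ?_, fun x => ⟨φ x, ?_⟩, fun y => ⟨φ.symm y, ?_⟩, ?_⟩ (by linarith)
  · refine le_add_right ?_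
    rw [← hμ]
    refine le_trans (measure_mono ?_) (Measure.le_map_apply hm.aemeasurable _)
    intro x hx
    exact ⟨x, hx, by simp; linarith⟩
  · refine le_add_right ?_
    rw [← hμ, Measure.map_apply hm hA]
    exact measure_mono fun x hx => ⟨φ x, hx, by simp; linarith⟩
  · simp; linarith
  · simp; linarith
  · simp [hroot]; linarith


/-! ### Spaces at distance zero -/

/-- An ultrafilter replaces diagonal subsequences: limits exist at all points simultaneously. -/
theorem Ultrafilter.exists_tendsto_of_compactSpace {X Y : Type*} [TopologicalSpace Y]
    [CompactSpace Y] (U : Ultrafilter ℕ) (f : ℕ → X → Y) :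
    ∃ φ : X → Y, ∀ x, Tendsto (fun n => f n x) U (𝓝 (φ x)) := by
  have : ∀ x, ∃ y, Tendsto (fun n => f n x) U (𝓝 y) := fun x => by
    obtain ⟨y, -, hy⟩ := isCompact_univ.ultrafilter_le_nhds (U.map fun n => f n x) (by simp)
    exact ⟨y, hy⟩
  exact ⟨fun x => (this x).choose, fun x => (this x).choose_spec⟩

/-- A closed set is the decreasing intersection of its thickenings, and a finite measure is
continuous along it. -/
theorem measure_le_of_forall_thickening {Y : Type*} [MetricSpace Y] [MeasurableSpace Y]
    [OpensMeasurableSpace Y] (ν : Measure Y) [IsFiniteMeasure ν] {F : Set Y} (hF : IsClosed F)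
    {m : ℝ≥0∞}
    (h : ∀ ε : ℝ, 0 < ε → m ≤ ν (Metric.thickening ε F) + ENNReal.ofReal ε) : m ≤ ν F := by
  have h1 : Tendsto (fun ε : ℝ => ν (Metric.thickening ε F) + ENNReal.ofReal ε) (𝓝[>] 0)
      (𝓝 (ν F + ENNReal.ofReal 0)) := by
    refine (tendsto_measure_thickening_of_isClosed ⟨1, one_pos, measure_ne_top _ _⟩ hF).add ?_
    exact (ENNReal.continuous_ofReal.tendsto 0).mono_left nhdsWithin_le_nhds
  rw [ENNReal.ofReal_zero, add_zero] at h1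
  exact ge_of_tendsto h1 (eventually_nhdsWithin_of_forall fun ε hε => h ε hε)

theorem MMSpace.isFiniteMeasure (X : MMSpace) [CompactSpace X] : IsFiniteMeasure X.μ :=
  ⟨X.finite_of_isBounded univ Metric.isBounded_of_compactSpace⟩

/-- Choosing close partners gives maps `f n : X → Y` and `g n : Y → X`. The limit of `f n` along an
ultrafilter is isometric, and the limit of `g n` is a right inverse. By compactness `f n` is
uniformly close to the limit for suitable `n`, which transports the Prohorov bounds to closed sets
and their images. -/
theorem strongEquiv_of_ghpEDist_eq_zero {X Y : MMSpace} [CompactSpace X] [CompactSpace Y]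
    (h : ghpEDist X Y = 0) : StrongEquiv X Y := by
  have := X.isFiniteMeasure
  have := Y.isFiniteMeasure
  let e : ℕ → ℝ := fun n => 1 / ((n : ℝ) + 1)
  have he : ∀ n, 0 < e n := fun n => Nat.one_div_pos_of_nat
  have hlim : Tendsto e atTop (𝓝 0) := tendsto_one_div_add_atTop_nhds_zero_nat
  have hw : ∀ n, ∃ d : X → Y → ℝ, IsCoupling d ∧ LPLe d X.μ Y.μ (e n) ∧
      LPLe (fun y x => d x y) Y.μ X.μ (e n) ∧ (∀ x, ∃ y, d x y < e n) ∧ (∀ y, ∃ x, d x y < e n) ∧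
      d X.root Y.root < e n := fun n => by
    obtain ⟨d, a, b, c, hd, hlt⟩ := exists_ghpWitness_of_lt
      (h.trans_lt (ENNReal.ofReal_pos.2 (he n)))
    obtain ⟨y, hy⟩ := hd.left X.root
    have hb := (hd.coupling.nonneg _ _).trans_lt hy
    have hc := (hd.coupling.nonneg _ _).trans_lt hd.root
    have ha := hd.pos
    exact ⟨d, hd.coupling, hd.lp.mono (by linarith), hd.lp'.mono (by linarith),
      fun x => (hd.left x).imp fun y hy => by linarith,
      fun y => (hd.right y).imp fun x hx => by linarith, by linarith [hd.root]⟩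
  choose d hd hlp hlp' hl hr hroot using hw
  choose f hf using hl
  choose g hg using hr
  let U : Ultrafilter ℕ := hyperfilter ℕ
  have hU : (U : Filter ℕ) ≤ atTop := Nat.hyperfilter_le_atTop
  have hlimU : Tendsto e U (𝓝 0) := hlim.mono_left hU
  obtain ⟨φ, hφ⟩ := Ultrafilter.exists_tendsto_of_compactSpace U f
  obtain ⟨ψ, hψ⟩ := Ultrafilter.exists_tendsto_of_compactSpace U g
  -- the maps `f n` are almost isometric
  have hfd : ∀ n x y, dist (f n x) y < e n + d n x y := fun n x y => by
    linarith [(hd n).right_le x (f n x) y, hf n x]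
  have hff : ∀ n x x', |dist (f n x) (f n x') - dist x x'| ≤ 2 * e n := fun n x x' => by
    rw [abs_le]
    constructor
    · linarith [(hd n).left_le x x' (f n x), (hd n).right x' (f n x) (f n x'), hf n x, hf n x',
        dist_comm (f n x) (f n x')]
    · linarith [hfd n x (f n x'), (hd n).left x x' (f n x'), hf n x']
  have hiso : Isometry φ := by
    refine Isometry.of_dist_eq fun x x' => ?_
    refine tendsto_nhds_unique ((hφ x).dist (hφ x')) ?_
    rw [tendsto_iff_dist_tendsto_zero]
    refine squeeze_zero (fun _ => dist_nonneg) (fun n => hff n x x') ?_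
    simpa using hlimU.const_mul 2
  have hsurj : ∀ y, φ (ψ y) = y := fun y => by
    refine tendsto_nhds_unique (hφ (ψ y)) ?_
    rw [tendsto_iff_dist_tendsto_zero]
    refine squeeze_zero (g := fun n => e n + (dist (g n y) (ψ y) + e n)) (fun _ => dist_nonneg)
      (fun n => ?_) ?_
    · linarith [hfd n (ψ y) y, (hd n).left (ψ y) (g n y) y, hg n y, dist_comm (ψ y) (g n y)]
    · simpa using hlimU.add ((tendsto_iff_dist_tendsto_zero.1 (hψ y)).add hlimU)
  have hrootφ : φ X.root = Y.root := by
    refine tendsto_nhds_unique (hφ X.root) ?_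
    rw [tendsto_iff_dist_tendsto_zero]
    refine squeeze_zero (g := fun n => e n + e n) (fun _ => dist_nonneg)
      (fun n => ?_) ?_
    · linarith [hfd n X.root Y.root, hroot n]
    · simpa using hlimU.add hlimU
  -- uniform convergence along the ultrafilter
  have hunif : ∀ ε : ℝ, 0 < ε → ∃ n, e n < ε ∧ ∀ x, dist (φ x) (f n x) < 5 * ε := fun ε hε => by
    obtain ⟨t, -, htf, ht⟩ := (isCompact_univ (X := X)).finite_cover_balls hε
    have h1 : ∀ᶠ n in (U : Filter ℕ), ∀ s ∈ t, dist (f n s) (φ s) < ε :=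
      (eventually_all_finite htf).2 fun s _ => (Metric.tendsto_nhds.1 (hφ s)) ε hε
    have h2 : ∀ᶠ n in (U : Filter ℕ), e n < ε := hlimU.eventually (gt_mem_nhds hε)
    obtain ⟨n, hn1, hn2⟩ := (h1.and h2).exists
    refine ⟨n, hn2, fun x => ?_⟩
    obtain ⟨s, hs, hxs⟩ := mem_iUnion₂.1 (ht (mem_univ x))
    have hxs : dist x s < ε := hxs
    have h3 := hff n x s
    rw [abs_le] at h3
    -- The three distances are below `ε`, `ε` and `ε + 2 * e n < 3 * ε`, whence the constant 5.
    linarith [dist_triangle4 (φ x) (φ s) (f n s) (f n x), hiso.dist_eq x s, hn1 s hs,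
      dist_comm (f n s) (φ s), dist_comm (f n s) (f n x)]
  have key : ∀ A : Set X, IsClosed A → X.μ A = Y.μ (φ '' A) := fun A hA => by
    have hA' : IsClosed (φ '' A) := (hA.isCompact.image hiso.continuous).isClosed
    refine le_antisymm (measure_le_of_forall_thickening _ hA' fun ε hε => ?_)
      (measure_le_of_forall_thickening _ hA fun ε hε => ?_)
    -- Uniform closeness costs `5 * ε / 7`; the bound `hfd` and the neighbourhood radius cost `e n <
    -- ε / 7` each.
    · obtain ⟨n, hn, hx⟩ := hunif (ε / 7) (by linarith)
      refine (hlp n A hA.measurableSet).trans (add_le_add (measure_mono ?_)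
        (ENNReal.ofReal_le_ofReal (by linarith)))
      rintro y ⟨x, hxA, hxy⟩
      refine Metric.mem_thickening_iff.2 ⟨φ x, mem_image_of_mem _ hxA, ?_⟩
      linarith [dist_triangle_right y (φ x) (f n x), hx x, hfd n x y, dist_comm y (f n x)]
    · obtain ⟨n, hn, hx⟩ := hunif (ε / 7) (by linarith)
      refine (hlp' n _ hA'.measurableSet).trans (add_le_add (measure_mono ?_)
        (ENNReal.ofReal_le_ofReal (by linarith)))
      rintro x ⟨_, ⟨x', hx', rfl⟩, hxx'⟩
      refine Metric.mem_thickening_iff.2 ⟨x', hx', ?_⟩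
      rw [← hiso.dist_eq]
      linarith [dist_triangle (φ x) (f n x) (φ x'), hx x, hfd n x (φ x')]
  let Φ : X ≃ᵢ Y := IsometryEquiv.mk' φ ψ hsurj hiso
  refine ⟨Φ, hrootφ, ?_⟩
  have hm : Measurable φ := hiso.continuous.measurable
  have hpre : ∀ B : Set Y, φ '' (φ ⁻¹' B) = B := fun B =>
    image_preimage_eq B fun y => ⟨ψ y, hsurj y⟩
  refine ext_of_generate_finite {s | IsClosed s} ?_ isPiSystem_isClosed ?_ ?_
  · rw [← borel_eq_generateFrom_isClosed, BorelSpace.measurable_eq (α := Y)]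
  · intro B hB
    change X.μ.map φ B = Y.μ B
    rw [Measure.map_apply hm (IsClosed.measurableSet hB),
      key _ (IsClosed.preimage hiso.continuous hB), hpre]
  · change X.μ.map φ univ = Y.μ univ
    rw [Measure.map_apply hm .univ, key _ (isClosed_univ.preimage hiso.continuous), hpre]


/-! ### Cores and lower mass functions -/

instance (X : MMSpace) : SecondCountableTopology X := UniformSpace.secondCountable_of_separable X

theorem MMSpace.mem_support_iff {X : MMSpace} {x : X} :
    x ∈ X.μ.support ↔ ∀ ε : ℝ, 0 < ε → 0 < X.μ (Metric.ball x ε) :=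
  Metric.nhds_basis_ball.mem_measureSupport

theorem MMSpace.measure_coreSet_compl (X : MMSpace) : X.μ X.coreSetᶜ = 0 :=
  measure_mono_null (compl_subset_compl.2 subset_union_left) Measure.measure_compl_support

/-- The inclusion of the core. -/
def MMSpace.coreVal (X : MMSpace) : X.core → X := fun z : X.coreSet => (z : X)

theorem MMSpace.isometry_coreVal (X : MMSpace) : Isometry X.coreVal := isometry_subtype_coe

theorem MMSpace.core_apply (X : MMSpace) (s : Set X.core) : X.core.μ s = X.μ (X.coreVal '' s) :=
  (MeasurableEmbedding.subtype_coe X.isClosed_coreSet.measurableSet).comap_apply _ _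

theorem MMSpace.core_apply_preimage (X : MMSpace) (s : Set X) :
    X.core.μ (X.coreVal ⁻¹' s) = X.μ s := by
  have h : X.coreVal '' (X.coreVal ⁻¹' s) = s ∩ X.coreSet := Subtype.image_preimage_coe _ _ |>.trans
    (inter_comm _ _)
  rw [core_apply, h, measure_inter_conull X.measure_coreSet_compl]

theorem MMSpace.measurableSet_image_coreVal (X : MMSpace) {s : Set X.core} (hs : MeasurableSet s) :
    MeasurableSet (X.coreVal '' s) :=
  (MeasurableEmbedding.subtype_coe X.isClosed_coreSet.measurableSet).measurableSet_image.2 hs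

theorem MMSpace.core_support (X : MMSpace) : X.core.μ.support = X.coreVal ⁻¹' X.μ.support := by
  ext z
  rw [mem_preimage, mem_support_iff, mem_support_iff]
  refine forall₂_congr fun ε _ => ?_
  rw [← X.core_apply_preimage, X.isometry_coreVal.preimage_ball]

theorem MMSpace.exists_coreVal_eq {X : MMSpace} {x : X} (hx : x ∈ X.μ.support) :
    ∃ z : X.core, X.coreVal z = x ∧ z ∈ X.core.μ.support := by
  refine ⟨(⟨x, Or.inl hx⟩ : X.coreSet), rfl, ?_⟩
  rw [core_support]
  exact hx

theorem MMSpace.mem_support_or_eq_root {X : MMSpace} (z : X.core) :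
    z ∈ X.core.μ.support ∨ z = X.core.root := by
  rw [core_support]
  rcases (z : X.coreSet).2 with h | h
  · exact Or.inl h
  · exact Or.inr (Subtype.ext h)

theorem MMSpace.coreSet_core (X : MMSpace) : X.core.coreSet = univ :=
  eq_univ_of_forall fun z => mem_support_or_eq_root z

theorem strongEquiv_core {X : MMSpace} (h : X.coreSet = univ) : StrongEquiv X.core X := by
  let φ : X.core ≃ᵢ X := IsometryEquiv.mk' X.coreVal
    (fun x => (⟨x, h ▸ mem_univ x⟩ : X.coreSet)) (fun x => rfl) X.isometry_coreVal
  refine ⟨φ, rfl, ?_⟩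
  ext s hs
  rw [Measure.map_apply φ.continuous.measurable hs]
  exact X.core_apply_preimage s

theorem mmClass_mk_core (X : MMSpace) : MMClass.mk X.core = MMClass.mk X :=
  Quotient.sound (strongEquiv_core X.coreSet_core)

instance (X : MMSpace) [CompactSpace X] : CompactSpace X.core :=
  isCompact_iff_compactSpace.1 X.isClosed_coreSet.isCompact

theorem mmClass_isCompact_iff {X : MMSpace} : (MMClass.mk X).IsCompact ↔ CompactSpace X.core := by
  constructor
  · rintro ⟨Y, hY, hc⟩
    obtain ⟨φ, -⟩ : StrongEquiv Y.core X.core := Quotient.exact hY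
    exact φ.toHomeomorph.compactSpace
  · exact fun h => ⟨X.core, mmClass_mk_core X, h⟩

/-- The balls around the root exhaust the space, so the localization disappears. -/
theorem lowerMass_eq (δ : ℝ) (X : MMSpace) :
    lowerMass δ X = ⨅ x ∈ X.μ.support, X.μ (Metric.closedBall x δ) := by
  refine le_antisymm (le_iInf₂ fun x hx => ?_) ?_
  · refine (iInf₂_le (dist x X.root + 1) (by positivity)).trans (iInf₂_le x ⟨?_, hx⟩)
    exact Metric.mem_ball.2 (lt_add_one (dist x X.root))
  · exact le_iInf₂ fun R _ => le_iInf₂ fun x hx => iInf₂_le x hx.2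

theorem lowerMass_le {δ : ℝ} {X : MMSpace} {x : X} (hx : x ∈ X.μ.support) :
    lowerMass δ X ≤ X.μ (Metric.closedBall x δ) := by
  rw [lowerMass_eq]
  exact iInf₂_le x hx

theorem le_lowerMass {δ : ℝ} {X : MMSpace} {m : ℝ≥0∞}
    (h : ∀ x ∈ X.μ.support, m ≤ X.μ (Metric.closedBall x δ)) : m ≤ lowerMass δ X := by
  rw [lowerMass_eq]
  exact le_iInf₂ h

theorem lowerMass_mono (X : MMSpace) : Monotone (fun δ => lowerMass δ X) := fun _ _ h =>
  le_lowerMass fun _ hx => (lowerMass_le hx).trans (measure_mono (Metric.closedBall_subset_closedBall h))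

theorem lowerMass_core (δ : ℝ) (X : MMSpace) : lowerMass δ X.core = lowerMass δ X := by
  refine le_antisymm (le_lowerMass fun x hx => ?_) (le_lowerMass fun z hz => ?_)
  · obtain ⟨z, rfl, hz⟩ := MMSpace.exists_coreVal_eq hx
    refine (lowerMass_le hz).trans_eq ?_
    rw [← X.core_apply_preimage, X.isometry_coreVal.preimage_closedBall]
  · have hz' := hz
    rw [X.core_support] at hz'
    refine (lowerMass_le hz').trans_eq ?_
    rw [← X.core_apply_preimage, X.isometry_coreVal.preimage_closedBall]

theorem StrongEquiv.lowerMass_le {X Y : MMSpace} (h : StrongEquiv X Y) (δ : ℝ) :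
    lowerMass δ X ≤ lowerMass δ Y := by
  obtain ⟨φ, -, hμ⟩ := h
  have hb : ∀ s, MeasurableSet s → Y.μ s = X.μ (φ ⁻¹' s) := fun s hs => by
    rw [← hμ, Measure.map_apply φ.continuous.measurable hs]
  refine le_lowerMass fun y hy => ?_
  obtain ⟨x, rfl⟩ := φ.surjective y
  rw [hb _ Metric.isClosed_closedBall.measurableSet, φ.isometry.preimage_closedBall]
  refine SupportGHP.lowerMass_le (MMSpace.mem_support_iff.2 fun ε hε => ?_)
  rw [← φ.isometry.preimage_ball, ← hb _ Metric.isOpen_ball.measurableSet]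
  exact MMSpace.mem_support_iff.1 hy ε hε

theorem StrongEquiv.lowerMass_eq {X Y : MMSpace} (h : StrongEquiv X Y) (δ : ℝ) :
    lowerMass δ X = lowerMass δ Y :=
  le_antisymm (h.lowerMass_le δ) ((strongEquiv_equivalence.symm h).lowerMass_le δ)

/-- Finitely many balls of radius `δ / 2` centred in the support cover it, and each `δ`-ball around
a support point contains one of them. -/
theorem lowerMass_pos (X : MMSpace) [CompactSpace X] {δ : ℝ} (hδ : 0 < δ) : 0 < lowerMass δ X := by
  obtain ⟨t, hts, htf, ht⟩ :=
    (Measure.isClosed_support (μ := X.μ)).isCompact.finite_cover_balls (half_pos hδ)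
  have hpos : 0 < htf.toFinset.inf fun s => X.μ (Metric.ball s (δ / 2)) := by
    rw [Finset.lt_inf_iff ENNReal.zero_lt_top]
    exact fun s hs => MMSpace.mem_support_iff.1 (hts (htf.mem_toFinset.1 hs)) _ (half_pos hδ)
  refine hpos.trans_le (le_lowerMass fun x hx => ?_)
  obtain ⟨s, hs, hxs⟩ := mem_iUnion₂.1 (ht hx)
  refine (Finset.inf_le (htf.mem_toFinset.2 hs)).trans (measure_mono fun z hz => ?_)
  rw [Metric.mem_ball] at hxs hz
  rw [Metric.mem_closedBall]
  linarith [dist_triangle_right z x s]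

/-! ### The two parts of the support Gromov-Hausdorff-Prohorov distance -/

/-- The part of the distance that compares the lower mass functions. -/
def lowerMassEDist (X Y : MMSpace) : ℝ≥0∞ :=
  ∫⁻ δ in Icc (0 : ℝ) 1,
    min 1 (ENNReal.ofReal |(1 / lowerMass δ X).toReal - (1 / lowerMass δ Y).toReal|)

theorem sGHPEDist_eq (X Y : MMSpace) :
    sGHPEDist X Y = ghpEDist X.core Y.core + lowerMassEDist X Y := rfl

theorem measurable_lowerMass_inv (X : MMSpace) :
    Measurable fun δ => (1 / lowerMass δ X).toReal :=
  ((lowerMass_mono X).measurable.const_div 1).ennreal_toReal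

theorem lowerMassEDist_comm (X Y : MMSpace) : lowerMassEDist X Y = lowerMassEDist Y X := by
  simp only [lowerMassEDist, abs_sub_comm]

theorem lowerMassEDist_self (X : MMSpace) : lowerMassEDist X X = 0 := by
  simp [lowerMassEDist]

theorem measurable_lowerMassEDist_integrand (X Y : MMSpace) : Measurable fun δ : ℝ =>
    min 1 (ENNReal.ofReal |(1 / lowerMass δ X).toReal - (1 / lowerMass δ Y).toReal|) := by
  have h := (measurable_lowerMass_inv X).sub (measurable_lowerMass_inv Y)
  exact measurable_const.min (ENNReal.measurable_ofReal.comp (measurable_abs.comp h))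

theorem lowerMassEDist_triangle (X Y Z : MMSpace) :
    lowerMassEDist X Z ≤ lowerMassEDist X Y + lowerMassEDist Y Z := by
  rw [lowerMassEDist, lowerMassEDist, lowerMassEDist,
    ← lintegral_add_left (measurable_lowerMassEDist_integrand X Y)]
  refine lintegral_mono fun δ => ?_
  refine (min_le_min_left 1 ?_).trans (min_add_distrib 1 _ _ |>.trans_le (min_le_right _ _))
  rw [← ENNReal.ofReal_add (abs_nonneg _) (abs_nonneg _)]
  exact ENNReal.ofReal_le_ofReal (abs_sub_le _ _ _)

theorem lowerMassEDist_lt_top (X Y : MMSpace) : lowerMassEDist X Y < ⊤ := by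
  refine (lintegral_mono fun δ => min_le_left _ _).trans_lt ?_
  simp

theorem lowerMassEDist_core (X Y : MMSpace) :
    lowerMassEDist X.core Y.core = lowerMassEDist X Y := by
  simp only [lowerMassEDist, lowerMass_core]

theorem sGHPEDist_comm (X Y : MMSpace) : sGHPEDist X Y = sGHPEDist Y X := by
  rw [sGHPEDist_eq, sGHPEDist_eq, ghpEDist_comm, lowerMassEDist_comm]

theorem sGHPEDist_triangle (X Y Z : MMSpace) :
    sGHPEDist X Z ≤ sGHPEDist X Y + sGHPEDist Y Z := by
  simp only [sGHPEDist_eq]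
  refine (add_le_add (ghpEDist_triangle _ Y.core _) (lowerMassEDist_triangle _ Y _)).trans_eq ?_
  ring

theorem sGHPEDist_lt_top (X Y : MMSpace) [CompactSpace X.core] [CompactSpace Y.core] :
    sGHPEDist X Y < ⊤ :=
  ENNReal.add_lt_top.2 ⟨ghpEDist_lt_top _ _, lowerMassEDist_lt_top _ _⟩

theorem sGHPEDist_eq_zero_iff {X Y : MMSpace} [CompactSpace X.core] [CompactSpace Y.core] :
    sGHPEDist X Y = 0 ↔ StrongEquiv X.core Y.core := by
  rw [sGHPEDist_eq, add_eq_zero]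
  constructor
  · exact fun h => strongEquiv_of_ghpEDist_eq_zero h.1
  · refine fun h => ⟨h.ghpEDist_eq_zero, ?_⟩
    rw [← lowerMassEDist_core, ← nonpos_iff_eq_zero, ← lowerMassEDist_self Y.core]
    simp only [lowerMassEDist, h.lowerMass_eq, le_refl]


/-! ### Closeness of roots, supports and measures -/

/-- The cross distance `d` witnesses that the roots, the supports and the measures are
`ε`-close. -/
structure SClose (X Y : MMSpace) (d : X → Y → ℝ) (ε : ℝ) : Prop where
  coupling : IsCoupling d
  root : d X.root Y.root < ε
  left : ∀ x ∈ X.μ.support, ∃ y ∈ Y.μ.support, d x y < ε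
  right : ∀ y ∈ Y.μ.support, ∃ x ∈ X.μ.support, d x y < ε
  lp : LPLe d X.μ Y.μ ε
  lp' : LPLe (fun y x => d x y) Y.μ X.μ ε

namespace SClose

variable {X Y : MMSpace} {d : X → Y → ℝ} {ε : ℝ}

theorem pos (h : SClose X Y d ε) : 0 < ε := (h.coupling.nonneg _ _).trans_lt h.root

theorem flip (h : SClose X Y d ε) : SClose Y X (fun y x => d x y) ε :=
  ⟨h.coupling.flip, h.root, h.right, h.left, h.lp', h.lp⟩

theorem mono {ε' : ℝ} (h : SClose X Y d ε) (hε : ε ≤ ε') : SClose X Y d ε' where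
  coupling := h.coupling
  root := h.root.trans_le hε
  left x hx := (h.left x hx).imp fun _ hy => ⟨hy.1, hy.2.trans_le hε⟩
  right y hy := (h.right y hy).imp fun _ hx => ⟨hx.1, hx.2.trans_le hε⟩
  lp := h.lp.mono hε
  lp' := h.lp'.mono hε

theorem lp_core {d : X → Y → ℝ} (h : LPLe d X.μ Y.μ ε) :
    LPLe (fun x y => d (X.coreVal x) (Y.coreVal y)) X.core.μ Y.core.μ ε := by
  intro A hA
  rw [X.core_apply]
  refine (h _ (X.measurableSet_image_coreVal hA)).trans ?_
  rw [← Y.core_apply_preimage]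
  refine add_le_add (measure_mono ?_) le_rfl
  rintro y ⟨_, ⟨x, hx, rfl⟩, hxy⟩
  exact ⟨x, hx, hxy⟩

theorem exists_core_left (h : SClose X Y d ε) (x : X.core) :
    ∃ y : Y.core, d (X.coreVal x) (Y.coreVal y) < ε := by
  rcases MMSpace.mem_support_or_eq_root x with hx | rfl
  · rw [X.core_support] at hx
    obtain ⟨y, hy, hxy⟩ := h.left _ hx
    obtain ⟨y, rfl, -⟩ := MMSpace.exists_coreVal_eq hy
    exact ⟨y, hxy⟩
  · exact ⟨Y.core.root, h.root⟩

theorem ghpWitness_core (h : SClose X Y d ε) :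
    GHPWitness X.core Y.core (fun x y => d (X.coreVal x) (Y.coreVal y)) ε ε ε where
  coupling := h.coupling.restrict X.isometry_coreVal Y.isometry_coreVal
  pos := h.pos
  lp := lp_core h.lp
  lp' := lp_core h.lp'
  left := h.exists_core_left
  right := h.flip.exists_core_left
  root := h.root

theorem ghpEDist_core_lt (h : SClose X Y d ε) :
    ghpEDist X.core Y.core < ENNReal.ofReal (4 * ε) :=
  h.ghpWitness_core.ghpEDist_lt (by linarith [h.pos])

/-- If `x` is within `ε` of `y`, then the `ε`-neighbourhood of the `δ`-ball around `x` lies in the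
`(δ + 2 * ε)`-ball around `y`. -/
theorem lowerMass_le (h : SClose X Y d ε) {δ δ' : ℝ} (hδ : δ + 2 * ε ≤ δ') :
    lowerMass δ X ≤ lowerMass δ' Y + ENNReal.ofReal ε := by
  rw [← tsub_le_iff_right]
  refine le_lowerMass fun y hy => ?_
  rw [tsub_le_iff_right]
  obtain ⟨x, hx, hxy⟩ := h.right y hy
  refine (SupportGHP.lowerMass_le hx).trans
    ((h.lp _ Metric.isClosed_closedBall.measurableSet).trans ?_)
  refine add_le_add (measure_mono ?_) le_rfl
  rintro y' ⟨x', hx', hxy'⟩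
  rw [Metric.mem_closedBall] at hx' ⊢
  linarith [h.coupling.right_le x' y' y, h.coupling.left x' x y]

end SClose

/-- If the lower mass exceeds the Prohorov distance, then the support is close to the other
support. -/
theorem exists_support_lt {X Y : MMSpace} {d : X → Y → ℝ} (hd : IsCoupling d) {a δ : ℝ}
    (h : LPLe d X.μ Y.μ a) (hm : ENNReal.ofReal a < lowerMass δ X) {x : X}
    (hx : x ∈ X.μ.support) : ∃ y ∈ Y.μ.support, d x y < δ + a := by
  have h1 := (hm.trans_le (lowerMass_le hx)).trans_le
    (h _ Metric.isClosed_closedBall.measurableSet)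
  -- The mass of the ball exceeds the error `a`, so its neighbourhood carries mass and meets the
  -- other support.
  have h2 : 0 < Y.μ {y | ∃ x' ∈ Metric.closedBall x δ, d x' y < a} := by
    by_contra hne
    rw [not_lt, nonpos_iff_eq_zero] at hne
    rw [hne, zero_add] at h1
    exact lt_irrefl _ h1
  obtain ⟨y, ⟨x', hx', hxy⟩, hy⟩ := Measure.nonempty_inter_support_of_pos h2
  rw [Metric.mem_closedBall] at hx'
  exact ⟨y, hy, by linarith [hd.left x x' y, dist_comm x x']⟩

/-- Eventually `m_δ (X n)` lies between `m_{δ-2ε} (Y) - ε` and `m_{δ+2ε} (Y) + ε`, and both tend to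
`m_δ (Y)` at a continuity point. -/
theorem tendsto_lowerMass {X : ℕ → MMSpace} {Y : MMSpace}
    (h : ∀ ε : ℝ, 0 < ε → ∀ᶠ n in atTop, ∃ d, SClose (X n) Y d ε) {δ : ℝ}
    (hδ : ContinuousAt (fun δ => lowerMass δ Y) δ) :
    Tendsto (fun n => lowerMass δ (X n)) atTop (𝓝 (lowerMass δ Y)) := by
  have hid : Tendsto (fun ε : ℝ => ε) (𝓝[>] 0) (𝓝 0) := nhdsWithin_le_nhds
  have hofReal : Tendsto (fun ε : ℝ => ENNReal.ofReal ε) (𝓝[>] 0) (𝓝 0) := by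
    simpa using ENNReal.tendsto_ofReal hid
  have hl : Tendsto (fun ε => lowerMass (δ - 2 * ε) Y - ENNReal.ofReal ε) (𝓝[>] 0)
      (𝓝 (lowerMass δ Y)) := by
    have h1 : Tendsto (fun ε : ℝ => δ - 2 * ε) (𝓝[>] 0) (𝓝 δ) := by
      simpa using (hid.const_mul 2).const_sub δ
    simpa using ENNReal.Tendsto.sub (hδ.tendsto.comp h1) hofReal (Or.inr ENNReal.zero_ne_top)
  have hr : Tendsto (fun ε => lowerMass (δ + 2 * ε) Y + ENNReal.ofReal ε) (𝓝[>] 0)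
      (𝓝 (lowerMass δ Y)) := by
    have h1 : Tendsto (fun ε : ℝ => δ + 2 * ε) (𝓝[>] 0) (𝓝 δ) := by
      simpa using (hid.const_mul 2).const_add δ
    simpa using (hδ.tendsto.comp h1).add hofReal
  refine tendsto_order.2 ⟨fun m hm => ?_, fun m hm => ?_⟩
  · obtain ⟨ε, hε, hε0⟩ := ((hl.eventually (lt_mem_nhds hm)).and self_mem_nhdsWithin).exists
    refine (h ε hε0).mono fun n ⟨d, hd⟩ => hε.trans_le ?_
    exact tsub_le_iff_right.2 (hd.flip.lowerMass_le (by linarith))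
  · obtain ⟨ε, hε, hε0⟩ := ((hr.eventually (gt_mem_nhds hm)).and self_mem_nhdsWithin).exists
    exact (h ε hε0).mono fun n ⟨d, hd⟩ => (hd.lowerMass_le (by linarith)).trans_lt hε

/-- A monotone function has countably many discontinuities, so the integrand tends to zero almost
everywhere; it is dominated by 1. Positivity keeps the reciprocals of the limit finite. -/
theorem tendsto_lowerMassEDist {X : ℕ → MMSpace} {Y : MMSpace}
    (hpos : ∀ δ : ℝ, 0 < δ → 0 < lowerMass δ Y)
    (h : ∀ ε : ℝ, 0 < ε → ∀ᶠ n in atTop, ∃ d, SClose (X n) Y d ε) :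
    Tendsto (fun n => lowerMassEDist (X n) Y) atTop (𝓝 0) := by
  have key := tendsto_lintegral_of_dominated_convergence
    (μ := (volume : Measure ℝ).restrict (Icc 0 1)) (f := fun _ => 0)
    (F := fun n δ => min 1 (ENNReal.ofReal
      |(1 / lowerMass δ (X n)).toReal - (1 / lowerMass δ Y).toReal|)) (fun _ => 1)
    (fun n => measurable_lowerMassEDist_integrand _ _)
    (fun n => ae_of_all _ fun δ => min_le_left _ _) (by simp) ?_
  · rw [lintegral_zero] at key
    exact key
  have hc : ∀ᵐ δ ∂(volume : Measure ℝ).restrict (Icc 0 1),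
      ContinuousAt (fun δ => lowerMass δ Y) δ := by
    have := (lowerMass_mono Y).countable_not_continuousAt.ae_notMem
      ((volume : Measure ℝ).restrict (Icc 0 1))
    filter_upwards [this] with δ hδ
    exact not_not.1 hδ
  have h0 : ∀ᵐ δ ∂(volume : Measure ℝ).restrict (Icc 0 1), δ ≠ 0 :=
    (countable_singleton (0 : ℝ)).ae_notMem _
  filter_upwards [hc, h0, ae_restrict_mem measurableSet_Icc] with δ hδ hδ0 hδm
  have hpos' := hpos δ (lt_of_le_of_ne hδm.1 hδ0.symm)
  have h1 : Tendsto (fun n => (1 / lowerMass δ (X n)).toReal) atTop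
      (𝓝 (1 / lowerMass δ Y).toReal) := by
    simp only [one_div]
    exact (ENNReal.tendsto_toReal (ENNReal.inv_ne_top.2 hpos'.ne')).comp
      (tendsto_lowerMass h hδ).inv
  have h2 := ENNReal.tendsto_ofReal (h1.sub_const (1 / lowerMass δ Y).toReal).abs
  simpa using (tendsto_const_nhds (x := (1 : ℝ≥0∞))).min h2

theorem tendsto_sGHPEDist {X : ℕ → MMSpace} {Y : MMSpace}
    (hpos : ∀ δ : ℝ, 0 < δ → 0 < lowerMass δ Y)
    (h : ∀ ε : ℝ, 0 < ε → ∀ᶠ n in atTop, ∃ d, SClose (X n) Y d ε) :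
    Tendsto (fun n => sGHPEDist (X n) Y) atTop (𝓝 0) := by
  have h1 : Tendsto (fun n => ghpEDist (X n).core Y.core) atTop (𝓝 0) := by
    refine tendsto_order.2 ⟨fun m hm => absurd hm not_lt_bot, fun m hm => ?_⟩
    obtain ⟨r, hr0, hr⟩ := ENNReal.lt_iff_exists_nnreal_btwn.1 hm
    have hr0' : (0 : ℝ) < r := by exact_mod_cast hr0
    refine (h (r / 4) (by linarith)).mono fun n ⟨d, hd⟩ => hd.ghpEDist_core_lt.trans ?_
    rw [mul_div_cancel₀ _ (by norm_num), ENNReal.ofReal_coe_nnreal]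
    exact hr
  simpa [sGHPEDist_eq] using h1.add (tendsto_lowerMassEDist hpos h)

/-- A lower bound for the lower mass in terms of the lower mass of a nearby space. -/
theorem lowerMass_ge_of_lowerMassEDist_lt {X Z : MMSpace} {δ : ℝ} (hδ : 0 < δ) (hδ1 : δ ≤ 1)
    (hX : 0 < lowerMass (δ / 2) X) (hZ : ∀ δ : ℝ, 0 < δ → 0 < lowerMass δ Z)
    (h : lowerMassEDist X Z < ENNReal.ofReal (δ / 2)) :
    ENNReal.ofReal (1 / ((1 / lowerMass (δ / 2) X).toReal + 1)) ≤ lowerMass δ Z := by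
  set L := (1 / lowerMass (δ / 2) X).toReal with hL
  have hL0 : 0 ≤ L := ENNReal.toReal_nonneg
  by_contra hlt
  rw [not_le] at hlt
  have htop : ∀ {x : ℝ≥0∞}, 0 < x → 1 / x ≠ ⊤ := fun hx => by
    rw [one_div]
    exact ENNReal.inv_ne_top.2 hx.ne'
  refine h.not_ge ?_
  -- If the bound failed, monotonicity would separate the reciprocals by at least 1 on the whole
  -- interval, which has length `δ / 2`.
  have h1 : ∀ s ∈ Icc (δ / 2) δ, (1 : ℝ≥0∞) ≤
      min 1 (ENNReal.ofReal |(1 / lowerMass s X).toReal - (1 / lowerMass s Z).toReal|) := by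
    intro s hs
    have hs0 : 0 < s := by linarith [hs.1]
    have e1 : (1 / lowerMass s X).toReal ≤ L :=
      ENNReal.toReal_mono (htop hX) (ENNReal.div_le_div_left (lowerMass_mono X hs.1) _)
    have e2 : L + 1 ≤ (1 / lowerMass s Z).toReal := by
      have e3 : lowerMass s Z ≤ ENNReal.ofReal (1 / (L + 1)) :=
        (lowerMass_mono Z hs.2).trans hlt.le
      -- Positivity excludes `1 / 0 = ⊤`, whose `toReal` would be 0.
      rw [← ENNReal.ofReal_le_iff_le_toReal (htop (hZ s hs0))]
      refine le_trans (le_of_eq ?_) (ENNReal.div_le_div_left e3 1)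
      rw [one_div (L + 1), ENNReal.ofReal_inv_of_pos (by linarith), one_div, inv_inv]
    refine le_min le_rfl ?_
    rw [ENNReal.one_le_ofReal, abs_sub_comm, le_abs]
    left
    linarith
  calc ENNReal.ofReal (δ / 2) = ∫⁻ _ in Icc (δ / 2) δ, 1 := by
        rw [setLIntegral_one, Real.volume_Icc]
        congr 1
        ring
    _ ≤ ∫⁻ s in Icc (δ / 2) δ, min 1 (ENNReal.ofReal
          |(1 / lowerMass s X).toReal - (1 / lowerMass s Z).toReal|) :=
        setLIntegral_mono' measurableSet_Icc h1
    _ ≤ _ := lintegral_mono_set (Icc_subset_Icc (by linarith) hδ1)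

theorem exists_sClose_of_sGHPEDist_lt {Y : MMSpace} [CompactSpace Y.core] {ε : ℝ} (hε : 0 < ε) :
    ∃ η : ℝ, 0 < η ∧ ∀ X : MMSpace, CompactSpace X.core → sGHPEDist X Y < ENNReal.ofReal η →
      ∃ d, SClose X.core Y.core d ε := by
  set δ := min (ε / 2) 1 with hδ
  have hδ0 : 0 < δ := lt_min (by linarith) one_pos
  have hδε : δ ≤ ε / 2 := min_le_left _ _
  set m := 1 / ((1 / lowerMass (δ / 2) Y.core).toReal + 1) with hm
  have hm0 : 0 < m := by positivity
  have hY := fun δ hδ => lowerMass_pos Y.core (δ := δ) hδ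
  -- `δ / 2` allows the comparison of lower masses, and `m` keeps the Prohorov bound below the
  -- resulting mass bound.
  refine ⟨min (δ / 2) m, lt_min (by linarith) hm0, fun X hXc hX => ?_⟩
  rw [sGHPEDist_eq] at hX
  have hX' := fun δ hδ => lowerMass_pos X.core (δ := δ) hδ
  have hmX : ENNReal.ofReal m ≤ lowerMass δ X.core := by
    refine lowerMass_ge_of_lowerMassEDist_lt hδ0 (min_le_right _ _) (hY _ (by linarith)) hX' ?_
    rw [lowerMassEDist_core, lowerMassEDist_comm]
    exact (le_add_self.trans_lt hX).trans_le (ENNReal.ofReal_le_ofReal (min_le_left _ _))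
  have hmY : ENNReal.ofReal m ≤ lowerMass δ Y.core := by
    refine lowerMass_ge_of_lowerMassEDist_lt hδ0 (min_le_right _ _) (hY _ (by linarith)) hY ?_
    rw [lowerMassEDist_self]
    exact ENNReal.ofReal_pos.2 (by linarith)
  obtain ⟨d, a, b, c, h, hlt⟩ := exists_ghpWitness_of_lt (le_self_add.trans_lt hX)
  have ha := h.pos
  have hb : 0 < b := by
    obtain ⟨y, hy⟩ := h.left X.core.root
    exact (h.coupling.nonneg _ _).trans_lt hy
  have hc : 0 < c := (h.coupling.nonneg _ _).trans_lt h.root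
  have h1 := min_le_left (δ / 2) m
  have h2 := min_le_right (δ / 2) m
  have ham : ENNReal.ofReal a < ENNReal.ofReal m :=
    (ENNReal.ofReal_lt_ofReal_iff hm0).2 (by linarith)
  refine ⟨d, h.coupling, by linarith [h.root], fun x hx => ?_, fun y hy => ?_,
    h.lp.mono (by linarith), h.lp'.mono (by linarith)⟩
  · obtain ⟨y, hy, hxy⟩ := exists_support_lt h.coupling h.lp (ham.trans_le hmX) hx
    exact ⟨y, hy, by linarith⟩
  · obtain ⟨x, hx, hxy⟩ := exists_support_lt h.coupling.flip h.lp' (ham.trans_le hmY) hy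
    exact ⟨x, hx, by linarith⟩


/-! ### Gluing a chain of metric spaces -/

/-- A metric space with an isometric copy of `A`. -/
structure Extension (A : Type) [MetricSpace A] : Type 1 where
  space : Type
  metric : MetricSpace space
  embed : A → space
  isometry : Isometry embed

instance {A : Type} [MetricSpace A] (G : Extension A) : MetricSpace G.space := G.metric

section ChainGluing

variable {A B : ℕ → Type} [∀ n, MetricSpace (A n)] [∀ n, Nonempty (A n)] [∀ n, MetricSpace (B n)]
  {p : ∀ n, A n → B n} {q : ∀ n, A (n + 1) → B n}

/-- The space `B 0 ⊔ ... ⊔ B (n - 1)`, where `B k` and `B (k + 1)` are glued along `A (k + 1)`. -/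
def chainExtension (hp : ∀ n, Isometry (p n)) (hq : ∀ n, Isometry (q n)) :
    ∀ n, Extension (A n)
  | 0 => ⟨A 0, inferInstance, id, isometry_id⟩
  | n + 1 =>
    { space := Metric.GlueSpace (chainExtension hp hq n).isometry (hp n)
      metric := inferInstance
      embed := Metric.toGlueR (chainExtension hp hq n).isometry (hp n) ∘ q n
      isometry := (Metric.toGlueR_isometry _ _).comp (hq n) }

/-- The isometric embeddings of the successive stages have an inductive limit. It is used with all
`A n` equal, to glue along one limit space, and with varying `A n`, to line up a Cauchy sequence. -/
theorem exists_chain_gluing (hp : ∀ n, Isometry (p n)) (hq : ∀ n, Isometry (q n)) :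
    ∃ (E : Type) (_ : MetricSpace E) (Ψ : ∀ n, B n → E), (∀ n, Isometry (Ψ n)) ∧
      ∀ n x, Ψ n (q n x) = Ψ (n + 1) (p (n + 1) x) := by
  let Y := chainExtension hp hq
  let f : ∀ n, (Y n).space → (Y (n + 1)).space := fun n =>
    Metric.toGlueL (Y n).isometry (hp n)
  have hf : ∀ n, Isometry (f n) := fun n => Metric.toGlueL_isometry _ _
  let g : ∀ n, B n → (Y (n + 1)).space := fun n => Metric.toGlueR (Y n).isometry (hp n)
  have hg : ∀ n, Isometry (g n) := fun n => Metric.toGlueR_isometry _ _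
  refine ⟨Metric.InductiveLimit hf, inferInstance,
    -- Stage 0 is `A 0`; the space `B n` enters at stage `n + 1`.
    fun n => Metric.toInductiveLimit hf (n + 1) ∘ g n,
    fun n => (Metric.toInductiveLimit_isometry _ _).comp (hg n), fun n x => ?_⟩
  have h1 : g (n + 1) (p (n + 1) x) = f (n + 1) ((Y (n + 1)).embed x) :=
    (congrFun (Metric.toGlue_commute (Y (n + 1)).isometry (hp (n + 1))) x).symm
  have h2 := congrFun (Metric.toInductiveLimit_commute hf (n + 1)) ((Y (n + 1)).embed x)
  change _ = Metric.toInductiveLimit hf (n + 2) (g (n + 1) (p (n + 1) x))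
  rw [h1]
  exact h2.symm

end ChainGluing

/-! ### Weak convergence and the Lévy-Prokhorov bounds -/

theorem eventually_le_add_of_tendsto {ι : Type*} {F : Filter ι} {u : ι → ℝ≥0∞} {c : ℝ≥0∞}
    (hc : c ≠ ⊤) (h : Tendsto u F (𝓝 c)) {ε : ℝ} (hε : 0 < ε) :
    ∀ᶠ n in F, c ≤ u n + ENNReal.ofReal ε ∧ u n ≤ c + ENNReal.ofReal ε := by
  have hlt : c < c + ENNReal.ofReal ε :=
    ENNReal.lt_add_right hc (ENNReal.ofReal_pos.2 hε).ne'
  filter_upwards [(h.add_const (ENNReal.ofReal ε)).eventually (lt_mem_nhds hlt),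
    h.eventually (gt_mem_nhds hlt)] with n h1 h2 using ⟨h1.le, h2.le⟩

/-- By compactness of `Y` every Borel set is approximated by a union of balls from one finite cover,
so only finitely many test functions matter. The other half of the condition follows from
convergence of the total masses. The filter is arbitrary because an ultrafilter is needed later. -/
theorem eventually_LPLe_of_tendsto {ι : Type*} {F : Filter ι} {X : ι → MMSpace} {Y : MMSpace}
    [∀ n, CompactSpace (X n)] [CompactSpace Y] {E : Type*} [MetricSpace E]
    {φ : ∀ n, X n → E} {φ₀ : Y → E} (hφ : ∀ n, Isometry (φ n)) (hφ₀ : Isometry φ₀)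
    (h : ∀ f : E →ᵇ ℝ≥0, Tendsto (fun n => ∫⁻ x, (f (φ n x) : ℝ≥0∞) ∂(X n).μ) F
      (𝓝 (∫⁻ y, (f (φ₀ y) : ℝ≥0∞) ∂Y.μ))) {ε : ℝ} (hε : 0 < ε) :
    ∀ᶠ n in F, LPLe (fun x y => dist (φ n x) (φ₀ y)) (X n).μ Y.μ ε ∧
      LPLe (fun y x => dist (φ n x) (φ₀ y)) Y.μ (X n).μ ε := by
  have := Y.isFiniteMeasure
  have := fun n => (X n).isFiniteMeasure
  -- Covering balls and thickening give one half of the condition with `3 * r`; passing to the other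
  -- half costs one more `r`.
  obtain ⟨r, hr⟩ : ∃ r, r = ε / 4 := ⟨_, rfl⟩
  have hr0 : 0 < r := by linarith
  obtain ⟨t, -, htf, ht⟩ := (isCompact_univ (X := Y)).finite_cover_balls hr0
  let S : Set Y → Set E := fun s => φ₀ '' ⋃ y ∈ s, Metric.ball y r
  let f : Set Y → E →ᵇ ℝ≥0 := fun s => thickenedIndicator hr0 (S s)
  have hfin : ∀ s, ∫⁻ y, (f s (φ₀ y) : ℝ≥0∞) ∂Y.μ ≠ ⊤ := fun s => by
    refine ((lintegral_mono (g := fun _ => 1) fun y => ?_).trans_lt ?_).ne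
    · exact ENNReal.coe_le_one_iff.2 (thickenedIndicator_le_one hr0 _ _)
    · simp
  have hev : ∀ᶠ n in F, ∀ s ∈ 𝒫 t, ∫⁻ y, (f s (φ₀ y) : ℝ≥0∞) ∂Y.μ ≤
      ∫⁻ x, (f s (φ n x) : ℝ≥0∞) ∂(X n).μ + ENNReal.ofReal r :=
    (eventually_all_finite htf.powerset).2 fun s _ =>
      (eventually_le_add_of_tendsto (hfin s) (h (f s)) hr0).mono fun n hn => hn.1
  have hmass : ∀ᶠ n in F, (X n).μ univ ≤ Y.μ univ + ENNReal.ofReal r := by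
    have h1 := h 1
    simp only [BoundedContinuousFunction.coe_one, Pi.one_apply, ENNReal.coe_one,
      lintegral_one] at h1
    exact (eventually_le_add_of_tendsto (measure_ne_top _ _) h1 hr0).mono fun n hn => hn.2
  filter_upwards [hev, hmass] with n hn hm
  have key : LPLe (fun y x => dist (φ n x) (φ₀ y)) Y.μ (X n).μ (3 * r) := by
    intro B hB
    set s : Set Y := {y ∈ t | (Metric.ball y r ∩ B).Nonempty} with hs
    have hsub : B ⊆ ⋃ y ∈ s, Metric.ball y r := fun b hb => by
      obtain ⟨y, hy, hby⟩ := mem_iUnion₂.1 (ht (mem_univ b))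
      exact mem_iUnion₂.2 ⟨y, ⟨hy, b, hby, hb⟩, hby⟩
    have h1 : Y.μ B ≤ ∫⁻ y, (f s (φ₀ y) : ℝ≥0∞) ∂Y.μ := by
      rw [← lintegral_indicator_one hB]
      refine lintegral_mono fun y => ?_
      by_cases hy : y ∈ B
      · have := thickenedIndicator_one hr0 (S s) (mem_image_of_mem φ₀ (hsub hy))
        simp [f, this, hy]
      · simp [hy]
    have hU : MeasurableSet (φ n ⁻¹' Metric.thickening r (S s)) :=
      (hφ n).measurableSet_preimage_thickening _ _
    have h2 : ∫⁻ x, (f s (φ n x) : ℝ≥0∞) ∂(X n).μ ≤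
        (X n).μ (φ n ⁻¹' Metric.thickening r (S s)) := by
      rw [← lintegral_indicator_one hU]
      refine lintegral_mono fun x => ?_
      by_cases hx : x ∈ φ n ⁻¹' Metric.thickening r (S s)
      · rw [indicator_of_mem hx]
        exact ENNReal.coe_le_one_iff.2 (thickenedIndicator_le_one hr0 _ _)
      · rw [indicator_of_notMem hx]
        simp [f, thickenedIndicator_zero hr0 _ hx]
    have h3 : φ n ⁻¹' Metric.thickening r (S s) ⊆
        {x | ∃ y ∈ B, dist (φ n x) (φ₀ y) < 3 * r} := by
      intro x hx
      obtain ⟨_, ⟨y', hy', rfl⟩, hxy⟩ := Metric.mem_thickening_iff.1 hx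
      obtain ⟨y, ⟨-, b, hb, hbB⟩, hy'⟩ := mem_iUnion₂.1 hy'
      rw [Metric.mem_ball] at hy' hb
      refine ⟨b, hbB, ?_⟩
      have := hφ₀.dist_eq y' b
      linarith [dist_triangle (φ n x) (φ₀ y') (φ₀ b), dist_triangle_right y' b y]
    calc Y.μ B ≤ ∫⁻ x, (f s (φ n x) : ℝ≥0∞) ∂(X n).μ + ENNReal.ofReal r :=
          h1.trans (hn s fun y hy => hy.1)
      _ ≤ _ := add_le_add (h2.trans (measure_mono h3)) (ENNReal.ofReal_le_ofReal (by linarith))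
  have hd := IsCoupling.of_isometry (hφ n) hφ₀
  exact ⟨(key.flip hd.flip (by linarith) hr0.le hm).mono (by linarith), key.mono (by linarith)⟩

/-- Truncating `b` at `β` makes it converge to `β`, and `a n ≤ a n + b n - min (b n) β` bounds `a`
from above. -/
theorem tendsto_of_le_liminf_of_add_tendsto {a b : ℕ → ℝ≥0∞} {α β : ℝ≥0∞} (hβ : β ≠ ⊤)
    (ha : α ≤ liminf a atTop) (hb : β ≤ liminf b atTop)
    (hab : Tendsto (fun n => a n + b n) atTop (𝓝 (α + β))) : Tendsto a atTop (𝓝 α) := by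
  have hmin : Tendsto (fun n => min (b n) β) atTop (𝓝 β) := by
    refine tendsto_order.2 ⟨fun c hc => ?_, fun c hc => ?_⟩
    · exact (eventually_lt_of_lt_liminf (hc.trans_le hb)).mono fun n hn => lt_min hn hc
    · exact Eventually.of_forall fun n => (min_le_right _ _).trans_lt hc
  refine tendsto_order.2 ⟨fun c hc => eventually_lt_of_lt_liminf (hc.trans_le ha),
    fun c hc => ?_⟩
  have h := ENNReal.Tendsto.sub hab hmin (Or.inr hβ)
  rw [ENNReal.add_sub_cancel_right hβ] at h
  refine (h.eventually (gt_mem_nhds hc)).mono fun n hn => lt_of_le_of_lt ?_ hn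
  exact ENNReal.le_sub_of_add_le_right (ne_top_of_le_ne_top hβ (min_le_right _ _))
    (add_le_add le_rfl (min_le_left _ _))

/-- The Prohorov bounds, applied to compact subsets, give lower semicontinuity of the mass of open
sets, hence of the integrals of `f` and of `c - f`. These add up to `c` times the total mass, which
converges. -/
theorem tendsto_lintegral_of_LPLe {X : ℕ → MMSpace} {Y : MMSpace}
    [∀ n, CompactSpace (X n)] [CompactSpace Y] {E : Type*} [MetricSpace E] [MeasurableSpace E]
    [BorelSpace E] {φ : ∀ n, X n → E} {φ₀ : Y → E} (hφ : ∀ n, Isometry (φ n)) (hφ₀ : Isometry φ₀)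
    (h : ∀ ε : ℝ, 0 < ε → ∀ᶠ n in atTop,
      LPLe (fun x y => dist (φ n x) (φ₀ y)) (X n).μ Y.μ ε ∧
      LPLe (fun y x => dist (φ n x) (φ₀ y)) Y.μ (X n).μ ε) (f : E →ᵇ ℝ≥0) :
    Tendsto (fun n => ∫⁻ z, (f z : ℝ≥0∞) ∂((X n).μ.map (φ n))) atTop
      (𝓝 (∫⁻ z, (f z : ℝ≥0∞) ∂(Y.μ.map φ₀))) := by
  have := Y.isFiniteMeasure
  have := fun n => (X n).isFiniteMeasure
  have hm := fun n => (hφ n).continuous.measurable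
  have hm₀ := hφ₀.continuous.measurable
  have hmass : Tendsto (fun n => (X n).μ.map (φ n) univ) atTop (𝓝 (Y.μ.map φ₀ univ)) := by
    rw [Measure.map_apply hm₀ .univ, preimage_univ]
    refine ENNReal.tendsto_nhds_of_Icc fun ε hε => ?_
    rcases eq_or_ne ε ⊤ with rfl | hεt
    · exact Eventually.of_forall fun n => ⟨by simp, by simp⟩
    filter_upwards [h ε.toReal (ENNReal.toReal_pos hε.ne' hεt)] with n hn
    rw [Measure.map_apply (hm n) .univ, preimage_univ]
    have h1 := hn.1.measure_univ_le
    have h2 := hn.2.measure_univ_le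
    rw [ENNReal.ofReal_toReal hεt] at h1 h2
    exact ⟨tsub_le_iff_right.2 h2, h1⟩
  have hG : ∀ G : Set E, IsOpen G →
      Y.μ.map φ₀ G ≤ liminf (fun n => (X n).μ.map (φ n) G) atTop := by
    intro G hGo
    rw [Measure.map_apply hm₀ hGo.measurableSet]
    refine le_of_forall_lt fun c hc => ?_
    obtain ⟨c', hcc', hc'⟩ := exists_between hc
    -- A compact set stays at a positive distance `δ` from the complement of the open set, so small
    -- neighbourhoods do not leave it.
    obtain ⟨K, hKG, hK, hcK⟩ := (hGo.preimage hφ₀.continuous).exists_lt_isCompact hc'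
    obtain ⟨δ, hδ, hδG⟩ := (hK.image hφ₀.continuous).exists_thickening_subset_open hGo
      (image_subset_iff.2 hKG)
    have hev : Tendsto (fun ε : ℝ => c' + ENNReal.ofReal ε) (𝓝[>] 0) (𝓝 c') := by
      simpa using tendsto_const_nhds.add
        (ENNReal.tendsto_ofReal
          (tendsto_id.mono_left (nhdsWithin_le_nhds (s := Ioi (0 : ℝ)) (a := 0))))
    obtain ⟨ε, ⟨hε1, hε2⟩, hε0⟩ := (((hev.eventually (gt_mem_nhds hcK)).and
      (nhdsWithin_le_nhds (gt_mem_nhds hδ))).and self_mem_nhdsWithin).exists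
    refine hcc'.trans_le (le_liminf_of_le (by isBoundedDefault) ?_)
    filter_upwards [h ε hε0] with n hn
    rw [Measure.map_apply (hm n) hGo.measurableSet]
    have h1 := hε1.le.trans (hn.2 K hK.measurableSet)
    refine ((ENNReal.add_le_add_iff_right ENNReal.ofReal_ne_top).1 h1).trans (measure_mono ?_)
    rintro x ⟨y, hy, hxy⟩
    exact hδG (Metric.mem_thickening_iff.2 ⟨_, mem_image_of_mem _ hy, hxy.trans hε2⟩)
  set c : ℝ≥0 := nndist f 0 with hc
  have hfc : ∀ z, f z ≤ c := fun z => BoundedContinuousFunction.NNReal.upper_bound f z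
  have hcont : Continuous fun z => (f z : ℝ) := NNReal.continuous_coe.comp f.continuous
  have h1 := lintegral_le_liminf_lintegral_of_forall_isOpen_measure_le_liminf_measure
    hcont (fun z => NNReal.coe_nonneg _) hG
  have h2 := lintegral_le_liminf_lintegral_of_forall_isOpen_measure_le_liminf_measure
    (f := fun z => (c : ℝ) - f z) (continuous_const.sub hcont)
    (fun z => sub_nonneg.2 (NNReal.coe_le_coe.2 (hfc z))) hG
  simp only [ENNReal.ofReal_coe_nnreal] at h1
  have hsum : ∀ κ : Measure E, ∫⁻ z, (f z : ℝ≥0∞) ∂κ + ∫⁻ z, ENNReal.ofReal ((c : ℝ) - f z) ∂κ =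
      c * κ univ := fun κ => by
    rw [← lintegral_add_left (f := fun z => (f z : ℝ≥0∞))
      (measurable_coe_nnreal_ennreal.comp f.continuous.measurable),
      ← lintegral_const]
    refine lintegral_congr fun z => ?_
    rw [← ENNReal.ofReal_coe_nnreal, ← ENNReal.ofReal_add (NNReal.coe_nonneg _)
      (sub_nonneg.2 (NNReal.coe_le_coe.2 (hfc z))), add_sub_cancel, ENNReal.ofReal_coe_nnreal]
  have hfin : (c : ℝ≥0∞) * Y.μ.map φ₀ univ ≠ ⊤ :=
    ENNReal.mul_ne_top ENNReal.coe_ne_top (measure_ne_top _ _)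
  refine tendsto_of_le_liminf_of_add_tendsto ?_ h1 h2 ?_
  · exact ne_top_of_le_ne_top hfin (le_add_self.trans_eq (hsum _))
  · simp only [hsum]
    exact ENNReal.Tendsto.const_mul hmass (Or.inr ENNReal.coe_ne_top)

/-! ### Gromov-Hausdorff-weak convergence -/

theorem ghpEDist_congr {X X' Y Y' : MMSpace} (h : StrongEquiv X X') (h' : StrongEquiv Y Y') :
    ghpEDist X Y = ghpEDist X' Y' := by
  have key : ∀ {X X' Y Y' : MMSpace}, StrongEquiv X X' → StrongEquiv Y Y' →
      ghpEDist X Y ≤ ghpEDist X' Y' := fun {X X' Y Y'} h h' => by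
    refine (ghpEDist_triangle X X' Y).trans ((add_le_add le_rfl
      (ghpEDist_triangle X' Y' Y)).trans ?_)
    rw [h.ghpEDist_eq_zero, ghpEDist_comm Y', h'.ghpEDist_eq_zero, zero_add, add_zero]
  exact le_antisymm (key h h')
    (key (strongEquiv_equivalence.symm h) (strongEquiv_equivalence.symm h'))

theorem sGHPEDist_congr {X X' Y Y' : MMSpace} (h : StrongEquiv X.core X'.core)
    (h' : StrongEquiv Y.core Y'.core) : sGHPEDist X Y = sGHPEDist X' Y' := by
  rw [sGHPEDist_eq, sGHPEDist_eq, ghpEDist_congr h h', ← lowerMassEDist_core X,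
    ← lowerMassEDist_core X']
  simp only [lowerMassEDist, h.lowerMass_eq, h'.lowerMass_eq]

theorem sGHPEDist_core (X Y : MMSpace) : sGHPEDist X.core Y.core = sGHPEDist X Y :=
  sGHPEDist_congr (strongEquiv_core X.coreSet_core) (strongEquiv_core Y.coreSet_core)

/-- Diagonal choice: for each `n`, a coupling that realizes the best precision `1 / (k + 1)` with `k
≤ n`. -/
theorem exists_seq_sClose {X : ℕ → MMSpace} {Y : MMSpace}
    (h : ∀ ε : ℝ, 0 < ε → ∀ᶠ n in atTop, ∃ d, SClose (X n) Y d ε) :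
    ∃ d : ∀ n, X n → Y → ℝ, (∀ n, IsCoupling (d n)) ∧
      ∀ ε : ℝ, 0 < ε → ∀ᶠ n in atTop, SClose (X n) Y (d n) ε := by
  classical
  let P : ℕ → ℕ → Prop := fun n k => ∃ d, SClose (X n) Y d (1 / ((k : ℝ) + 1))
  let k : ℕ → ℕ := fun n => Nat.findGreatest (P n) n
  have hd : ∀ n, ∃ d : X n → Y → ℝ, IsCoupling d ∧
      (P n (k n) → SClose (X n) Y d (1 / ((k n : ℝ) + 1))) := fun n => by
    by_cases hP : P n (k n)
    · obtain ⟨d, hd⟩ := hP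
      exact ⟨d, hd.coupling, fun _ => hd⟩
    -- `Nat.findGreatest` also returns 0 if no `k` qualifies; any coupling serves then.
    · exact ⟨_, IsCoupling.through (X n).root Y.root, fun h => absurd h hP⟩
  choose d hd hs using hd
  refine ⟨d, hd, fun ε hε => ?_⟩
  obtain ⟨K, hK⟩ := exists_nat_one_div_lt hε
  filter_upwards [h _ (Nat.one_div_pos_of_nat (n := K)), eventually_ge_atTop K] with n hn hKn
  have hle : K ≤ k n := Nat.le_findGreatest hKn hn
  have hP : P n (k n) := Nat.findGreatest_spec (P := P n) hKn hn
  exact (hs n hP).mono ((Nat.one_div_le_one_div hle).trans hK.le)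

theorem GHWConverges.eventually_sClose {X : ℕ → MMSpace} {X₀ : MMSpace}
    [∀ n, CompactSpace (X n).core] [CompactSpace X₀.core] (h : GHWConverges X X₀) {ε : ℝ}
    (hε : 0 < ε) : ∀ᶠ n in atTop, ∃ d, SClose (X n).core X₀.core d ε := by
  obtain ⟨E, _, _, _, ρ, φ, φ₀, hφ, hφ₀, hw, hH⟩ := h
  have hm : ∀ f : E →ᵇ ℝ≥0, Measurable fun z => (f z : ℝ≥0∞) := fun f =>
    measurable_coe_nnreal_ennreal.comp f.continuous.measurable
  have hw' : ∀ f : E →ᵇ ℝ≥0, Tendsto (fun n => ∫⁻ x, (f (φ n x) : ℝ≥0∞) ∂(X n).core.μ) atTop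
      (𝓝 (∫⁻ y, (f (φ₀ y) : ℝ≥0∞) ∂X₀.core.μ)) := fun f => by
    have h1 := hw f
    rw [lintegral_map (hm f) hφ₀.1.continuous.measurable] at h1
    refine h1.congr fun n => ?_
    rw [lintegral_map (hm f) (hφ n).1.continuous.measurable]
  filter_upwards [eventually_LPLe_of_tendsto (fun n => (hφ n).1) hφ₀.1 hw' hε,
    hH.eventually (gt_mem_nhds (ENNReal.ofReal_pos.2 hε))] with n hn hHn
  replace hHn : Metric.hausdorffEDist (φ n '' (X n).core.μ.support)
      (φ₀ '' X₀.core.μ.support) < ENNReal.ofReal ε := by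
    rw [MMSpace.core_support, MMSpace.core_support]
    exact hHn
  refine ⟨_, IsCoupling.of_isometry (hφ n).1 hφ₀.1, ?_, fun x hx => ?_, fun y hy => ?_, hn.1, hn.2⟩
  · rw [(hφ n).2, hφ₀.2, dist_self]
    exact hε
  · obtain ⟨_, ⟨y, hy, rfl⟩, hxy⟩ :=
      Metric.exists_edist_lt_of_hausdorffEDist_lt (mem_image_of_mem _ hx) hHn
    exact ⟨y, hy, by rwa [edist_dist, ENNReal.ofReal_lt_ofReal_iff hε] at hxy⟩
  · obtain ⟨_, ⟨x, hx, rfl⟩, hxy⟩ := Metric.exists_edist_lt_of_hausdorffEDist_lt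
      (mem_image_of_mem _ hy) (Metric.hausdorffEDist_comm.trans_lt hHn)
    exact ⟨x, hx, by rwa [edist_dist, dist_comm, ENNReal.ofReal_lt_ofReal_iff hε] at hxy⟩

theorem ghwConverges_of_sClose {X : ℕ → MMSpace} {X₀ : MMSpace}
    [∀ n, CompactSpace (X n).core] [CompactSpace X₀.core]
    (h : ∀ ε : ℝ, 0 < ε → ∀ᶠ n in atTop, ∃ d, SClose (X n).core X₀.core d ε) :
    GHWConverges X X₀ := by
  obtain ⟨d, hd, hs⟩ := exists_seq_sClose h
  -- A common root is required, so the roots are identified; this lengthens other cross distances by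
  -- at most the distance of the roots, which tends to zero.
  choose B hB i j hi hj hij using fun n => ((hd n).identify le_rfl).exists_isometry
  -- All `B n` are glued along the same copy of the limit space.
  obtain ⟨E, _, Ψ, hΨ, hΨj⟩ := exists_chain_gluing (A := fun _ => X₀.core) hj hj
  let φ₀ : X₀.core → E := Ψ 0 ∘ j 0
  let φ : ∀ n, (X n).core → E := fun n => Ψ n ∘ i n
  have hφ₀ : ∀ n y, φ₀ y = Ψ n (j n y) := fun n y => by
    induction n with
    | zero => rfl
    | succ n ih => rw [ih, hΨj]
  have hdist : ∀ n x y, dist (φ n x) (φ₀ y) = min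
      (d n x y + d n (X n).core.root X₀.core.root)
      (dist x (X n).core.root + dist X₀.core.root y) := fun n x y => by
    rw [hφ₀ n, ← hij]
    exact (hΨ n).dist_eq _ _
  have hφi : ∀ n, Isometry (φ n) := fun n => (hΨ n).comp (hi n)
  have hφ₀i : Isometry φ₀ := (hΨ 0).comp (hj 0)
  have hclose : ∀ ε : ℝ, 0 < ε → ∀ᶠ n in atTop,
      SClose (X n).core X₀.core (fun x y => dist (φ n x) (φ₀ y)) ε := fun ε hε => by
    filter_upwards [hs (ε / 2) (by linarith)] with n hn
    have hlt : ∀ x y, d n x y < ε / 2 → dist (φ n x) (φ₀ y) < ε := fun x y hxy => by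
      rw [hdist]
      exact (min_le_left _ _).trans_lt (by linarith [hn.root])
    refine ⟨IsCoupling.of_isometry (hφi n) hφ₀i, hlt _ _ hn.root, fun x hx => ?_, fun y hy => ?_,
      hn.lp.mono_dist (by linarith) hlt, hn.lp'.mono_dist (by linarith) fun y x => hlt x y⟩
    · exact (hn.left x hx).imp fun y hy => ⟨hy.1, hlt _ _ hy.2⟩
    · exact (hn.right y hy).imp fun x hx => ⟨hx.1, hlt _ _ hx.2⟩
  let _ : MeasurableSpace E := borel E
  have : BorelSpace E := ⟨rfl⟩
  refine ⟨E, inferInstance, inferInstance, inferInstance, φ₀ X₀.core.root, φ, φ₀,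
    fun n => ⟨hφi n, ?_⟩, ⟨hφ₀i, rfl⟩, fun f => ?_, ?_⟩
  · rw [← dist_le_zero, hdist]
    exact (min_le_right _ _).trans (by simp)
  · exact tendsto_lintegral_of_LPLe hφi hφ₀i (fun ε hε => (hclose ε hε).mono fun n hn =>
      ⟨hn.lp, hn.lp'⟩) f
  · suffices Tendsto (fun n => Metric.hausdorffEDist (φ n '' (X n).core.μ.support)
        (φ₀ '' X₀.core.μ.support)) atTop (𝓝 0) by
      simp only [MMSpace.core_support] at this
      exact this
    refine ENNReal.tendsto_nhds_zero.2 fun ε hε => ?_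
    rcases eq_or_ne ε ⊤ with rfl | hεt
    · exact Eventually.of_forall fun n => le_top
    filter_upwards [hclose ε.toReal (ENNReal.toReal_pos hε.ne' hεt)] with n hn
    refine Metric.hausdorffEDist_le_of_mem_edist ?_ ?_
    · rintro _ ⟨x, hx, rfl⟩
      obtain ⟨y, hy, hxy⟩ := hn.left x hx
      exact ⟨_, mem_image_of_mem _ hy, by
        rw [edist_dist, ENNReal.ofReal_le_iff_le_toReal hεt]; exact hxy.le⟩
    · rintro _ ⟨y, hy, rfl⟩
      obtain ⟨x, hx, hxy⟩ := hn.right y hy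
      exact ⟨_, mem_image_of_mem _ hx, by
        rw [edist_dist, dist_comm, ENNReal.ofReal_le_iff_le_toReal hεt]; exact hxy.le⟩

theorem tendsto_sGHPEDist_iff {X : ℕ → MMSpace} {X₀ : MMSpace}
    [∀ n, CompactSpace (X n).core] [CompactSpace X₀.core] :
    Tendsto (fun n => sGHPEDist (X n) X₀) atTop (𝓝 0) ↔
      ∀ ε : ℝ, 0 < ε → ∀ᶠ n in atTop, ∃ d, SClose (X n).core X₀.core d ε := by
  constructor
  · intro h ε hε
    obtain ⟨η, hη, hηX⟩ := exists_sClose_of_sGHPEDist_lt (Y := X₀) hε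
    exact (h.eventually (gt_mem_nhds (ENNReal.ofReal_pos.2 hη))).mono fun n hn =>
      hηX _ inferInstance hn
  · intro h
    have := tendsto_sGHPEDist (fun δ hδ => lowerMass_pos X₀.core hδ) h
    simpa only [sGHPEDist_core] using this

theorem ghwConverges_iff {X : ℕ → MMSpace} {X₀ : MMSpace}
    [∀ n, CompactSpace (X n).core] [CompactSpace X₀.core] :
    GHWConverges X X₀ ↔ Tendsto (fun n => sGHPEDist (X n) X₀) atTop (𝓝 0) := by
  rw [tendsto_sGHPEDist_iff]
  exact ⟨fun h ε hε => h.eventually_sClose hε, ghwConverges_of_sClose⟩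


/-! ### Limits of Cauchy sequences -/

/-- Closeness of roots and measures together with lower mass bounds implies closeness of the
supports. -/
theorem SClose.of_LPLe {X Y : MMSpace} {d : X → Y → ℝ} (hd : IsCoupling d) {ε δ a : ℝ}
    (hroot : d X.root Y.root < ε) (h : LPLe d X.μ Y.μ a) (h' : LPLe (fun y x => d x y) Y.μ X.μ a)
    (hX : ENNReal.ofReal a < lowerMass δ X) (hY : ENNReal.ofReal a < lowerMass δ Y)
    (hδ : 0 ≤ δ) (hε : δ + a ≤ ε) : SClose X Y d ε where
  coupling := hd
  root := hroot
  left _ hx := (exists_support_lt hd h hX hx).imp fun _ hy => ⟨hy.1, hy.2.trans_le hε⟩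
  right _ hy := (exists_support_lt hd.flip h' hY hy).imp fun _ hx => ⟨hx.1, hx.2.trans_le hε⟩
  lp := h.mono (by linarith)
  lp' := h'.mono (by linarith)

theorem exists_ofReal_le_lowerMass {X : MMSpace} [CompactSpace X] {δ : ℝ} (hδ : 0 < δ)
    (hδ1 : δ ≤ 1) : ∃ m : ℝ, 0 < m ∧ ∀ Z : MMSpace, CompactSpace Z →
      lowerMassEDist X Z < ENNReal.ofReal (δ / 2) → ENNReal.ofReal m ≤ lowerMass δ Z :=
  ⟨1 / ((1 / lowerMass (δ / 2) X).toReal + 1), by positivity, fun Z _ h =>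
    lowerMass_ge_of_lowerMassEDist_lt hδ hδ1 (lowerMass_pos X (by linarith))
      (fun δ hδ => lowerMass_pos Z hδ) h⟩

/-- Summing the geometric series, all later ranges lie within `2 * (1 / 2) ^ N` of the range of `f
N`, and the union of the first ones is compact. -/
theorem totallyBounded_iUnion_range {C : ℕ → Type*} [∀ n, MetricSpace (C n)]
    [∀ n, CompactSpace (C n)] {E : Type*} [MetricSpace E] {f : ∀ n, C n → E}
    (hf : ∀ n, Isometry (f n))
    (h : ∀ n x, ∃ y, dist (f n y) (f (n + 1) x) ≤ (1 / 2 : ℝ) ^ n) :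
    TotallyBounded (⋃ n, range (f n)) := by
  have hk : ∀ N k x, ∃ y, dist (f N y) (f (N + k) x) ≤
      2 * (1 / 2 : ℝ) ^ N - 2 * (1 / 2 : ℝ) ^ (N + k) := by
    intro N k
    induction k with
    | zero => exact fun x => ⟨x, by simp⟩
    | succ k ih =>
      intro x
      obtain ⟨z, hz⟩ := h (N + k) x
      obtain ⟨y, hy⟩ := ih z
      refine ⟨y, (dist_triangle _ (f (N + k) z) _).trans ((add_le_add hy hz).trans ?_)⟩
      rw [← add_assoc, pow_succ _ (N + k)]
      linarith
  refine Metric.totallyBounded_iff.2 fun ε hε => ?_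
  obtain ⟨N, hN⟩ := exists_pow_lt_of_lt_one (show 0 < ε / 4 by linarith) one_half_lt_one
  have hT : IsCompact (⋃ n ∈ Iic N, range (f n)) :=
    (finite_Iic N).isCompact_biUnion fun n _ => isCompact_range (hf n).continuous
  obtain ⟨t, -, htf, ht⟩ := hT.finite_cover_balls (half_pos hε)
  refine ⟨t, htf, ?_⟩
  rintro _ ⟨_, ⟨n, rfl⟩, x, rfl⟩
  obtain ⟨m, hm, y, hy⟩ : ∃ m ≤ N, ∃ y, dist (f m y) (f n x) < ε / 2 := by
    rcases le_total n N with hn | hn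
    · exact ⟨n, hn, x, by simpa using half_pos hε⟩
    · obtain ⟨k, rfl⟩ := Nat.exists_eq_add_of_le hn
      obtain ⟨y, hy⟩ := hk N k x
      refine ⟨N, le_rfl, y, hy.trans_lt ?_⟩
      have : (0 : ℝ) < (1 / 2) ^ (N + k) := by positivity
      linarith
  obtain ⟨z, hz, hyz⟩ := mem_iUnion₂.1 (ht (mem_biUnion (mem_Iic.2 hm) (mem_range_self y)))
  refine mem_iUnion₂.2 ⟨z, hz, ?_⟩
  rw [Metric.mem_ball] at hyz ⊢
  linarith [dist_triangle_left (f n x) z (f m y)]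

/-- Consecutive spaces are glued into a chain; in the completion the union of their images is
totally bounded. -/
theorem exists_compact_embedding {C : ℕ → MMSpace} [∀ n, CompactSpace (C n)]
    (hg : ∀ n, ghpEDist (C n) (C (n + 1)) < ENNReal.ofReal ((1 / 2) ^ n)) :
    ∃ (S : Type) (_ : MetricSpace S), CompactSpace S ∧ ∃ f : ∀ n, C n → S,
      ∀ n, Isometry (f n) := by
  choose d a b c hd hlt using fun n => exists_ghpWitness_of_lt (hg n)
  choose B hB i j hi hj hij using fun n => (hd n).coupling.exists_isometry
  obtain ⟨E₀, _, Ψ, hΨ, hΨj⟩ := exists_chain_gluing (A := fun n => C n) hi hj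
  let f : ∀ n, C n → UniformSpace.Completion E₀ := fun n x => (Ψ n (i n x) : E₀)
  have hf : ∀ n, Isometry (f n) := fun n =>
    UniformSpace.Completion.coe_isometry.comp ((hΨ n).comp (hi n))
  have hdist : ∀ n x y, dist (f n x) (f (n + 1) y) = d n x y := fun n x y => by
    rw [← hij, ← (hΨ n).dist_eq, hΨj]
    exact UniformSpace.Completion.dist_eq _ _
  have htb := totallyBounded_iUnion_range hf fun n x => by
    obtain ⟨y, hy⟩ := (hd n).right x
    have h1 := (hd n).pos
    have h2 := ((hd n).coupling.nonneg _ _).trans_lt (hd n).root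
    exact ⟨y, by rw [hdist]; linarith [hlt n]⟩
  refine ⟨closure (⋃ n, range (f n)), inferInstance,
    isCompact_iff_compactSpace.1 (htb.closure.isCompact_of_isClosed isClosed_closure),
    fun n x => ⟨f n x, subset_closure (mem_iUnion.2 ⟨n, mem_range_self x⟩)⟩,
    fun n => Isometry.of_dist_eq fun x y => (hf n).dist_eq x y⟩

/-- The compact ambient space itself carries the limit root and measure; points outside the limit
core do not matter. Closeness at arbitrarily late indices suffices for a Cauchy sequence. -/
theorem exists_limit {C : ℕ → MMSpace} [∀ n, CompactSpace (C n)]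
    (hg : ∀ N n m, N ≤ n → N ≤ m → ghpEDist (C n) (C m) < ENNReal.ofReal ((1 / 2) ^ N))
    (hl : ∀ N n m, N ≤ n → N ≤ m → lowerMassEDist (C n) (C m) < ENNReal.ofReal ((1 / 2) ^ N)) :
    ∃ Y : MMSpace, CompactSpace Y ∧
      ∀ ε : ℝ, 0 < ε → ∀ N, ∃ n ≥ N, ∃ d, SClose (C n) Y d ε := by
  obtain ⟨S, _, _, f, hf⟩ := exists_compact_embedding fun n => hg n n (n + 1) le_rfl n.le_succ
  let _ : MeasurableSpace S := borel S
  have : BorelSpace S := ⟨rfl⟩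
  have := fun n => (C n).isFiniteMeasure
  let U : Ultrafilter ℕ := hyperfilter ℕ
  have hU : (U : Filter ℕ) ≤ atTop := Nat.hyperfilter_le_atTop
  obtain ⟨ρ, -, hρ⟩ := isCompact_univ.ultrafilter_le_nhds (U.map fun n => f n (C n).root)
    (by simp)
  let μs : ℕ → FiniteMeasure S := fun n => ⟨(C n).μ.map (f n), inferInstance⟩
  -- The Prohorov bound is less than `(1 / 2) ^ 0 = 1`; bounded mass makes the measures relatively
  -- compact.
  have hmass : ∀ n, (μs n).mass ≤ ((C 0).μ univ).toNNReal + 1 := fun n => by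
    obtain ⟨d, a, b, c, h, hlt⟩ := exists_ghpWitness_of_lt (hg 0 n 0 n.zero_le le_rfl)
    have hb : 0 < b := by
      obtain ⟨y, hy⟩ := h.left (C n).root
      exact (h.coupling.nonneg _ _).trans_lt hy
    have hc : 0 < c := (h.coupling.nonneg _ _).trans_lt h.root
    have h1 := (h.lp.mono (b := 1) (by linarith)).measure_univ_le
    rw [← ENNReal.coe_le_coe, FiniteMeasure.ennreal_mass, ENNReal.coe_add,
      ENNReal.coe_toNNReal (measure_ne_top _ _)]
    simpa [μs, Measure.map_apply (hf n).continuous.measurable .univ] using h1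
  obtain ⟨ν, -, hν⟩ := (isCompact_setOfPred_finiteMeasure_le_of_compactSpace S
    (((C 0).μ univ).toNNReal + 1)).ultrafilter_le_nhds (U.map μs)
    (tendsto_principal.2 (Eventually.of_forall hmass))
  let Y : MMSpace :=
    { carrier := S
      root := ρ
      μ := ν
      finite_of_isBounded := fun s _ => measure_lt_top _ _ }
  have hYc : CompactSpace Y := ‹CompactSpace S›
  have hw : ∀ g : S →ᵇ ℝ≥0, Tendsto (fun n => ∫⁻ x, (g (f n x) : ℝ≥0∞) ∂(C n).μ) U
      (𝓝 (∫⁻ y : Y, (g y : ℝ≥0∞) ∂Y.μ)) := fun g => by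
    have h1 := FiniteMeasure.tendsto_iff_forall_lintegral_tendsto.1
      (show Tendsto μs U (𝓝 ν) from hν) g
    refine h1.congr fun n => ?_
    exact lintegral_map (f := fun z => (g z : ℝ≥0∞))
      (measurable_coe_nnreal_ennreal.comp g.continuous.measurable) (hf n).continuous.measurable
  refine ⟨Y, hYc, fun ε hε N => ?_⟩
  set δ := min (ε / 2) 1 with hδ
  have hδ0 : 0 < δ := lt_min (by linarith) one_pos
  obtain ⟨K, hK⟩ := exists_pow_lt_of_lt_one (half_pos hδ0) one_half_lt_one
  obtain ⟨m, hm0, hm⟩ := exists_ofReal_le_lowerMass (X := C K) hδ0 (min_le_right _ _)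
  obtain ⟨m', hm'0, hm'⟩ := exists_ofReal_le_lowerMass (X := Y) hδ0 (min_le_right _ _)
  -- The Prohorov precision must stay below the lower mass bounds `m` of the late spaces and `m'` of
  -- the limit.
  obtain ⟨a, ha⟩ : ∃ a, a = min (ε / 2) (min m m' / 2) := ⟨_, rfl⟩
  have hmm : 0 < min m m' := lt_min hm0 hm'0
  have ha0 : 0 < a := ha ▸ lt_min (by linarith) (by linarith)
  have ha1 : a ≤ ε / 2 := ha ▸ min_le_left _ _
  have ha2 : a ≤ min m m' / 2 := ha ▸ min_le_right _ _
  have hroot : ∀ᶠ n in (U : Filter ℕ), dist (f n (C n).root) ρ < ε :=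
    Metric.tendsto_nhds.1 (show Tendsto (fun n => f n (C n).root) U (𝓝 ρ) from hρ) ε hε
  have hLP := eventually_LPLe_of_tendsto (Y := Y) (φ₀ := id) hf isometry_id hw ha0
  obtain ⟨n, ⟨hnroot, hnLP⟩, hnN⟩ :=
    ((hroot.and hLP).and (hU (eventually_ge_atTop (max N K)))).exists
  refine ⟨n, (le_max_left _ _).trans hnN, _, SClose.of_LPLe
    (IsCoupling.of_isometry (hf n) (isometry_id (α := S))) (δ := δ) (a := a) hnroot hnLP.1 hnLP.2
    ?_ ?_ hδ0.le (by linarith [min_le_left (ε / 2) 1])⟩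
  · refine lt_of_lt_of_le ?_ (hm (C n) inferInstance ((hl K K n le_rfl
      ((le_max_right _ _).trans hnN)).trans_le (ENNReal.ofReal_le_ofReal hK.le)))
    exact (ENNReal.ofReal_lt_ofReal_iff hm0).2 (by linarith [min_le_left m m'])
  · refine lt_of_lt_of_le ?_ (hm' Y hYc ?_)
    · exact (ENNReal.ofReal_lt_ofReal_iff hm'0).2 (by linarith [min_le_right m m'])
    · rw [lowerMassEDist_self]
      exact ENNReal.ofReal_pos.2 (by linarith)


/-! ### Finitely supported spaces -/

/-- A space whose measure is a sum of point masses at `x 0, ..., x N`, where `x 0` is the root and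
`P` is the set of indices with positive mass. -/
structure FinPres (N : ℕ) (P : Finset (Fin (N + 1))) : Type 1 where
  X : MMSpace
  compact : CompactSpace X.core
  x : Fin (N + 1) → X
  m : Fin (N + 1) → ℝ≥0
  root : x 0 = X.root
  pos : ∀ i, 0 < m i ↔ i ∈ P
  measure : ∀ A, MeasurableSet A → X.μ A = ∑ i, (m i : ℝ≥0∞) * A.indicator 1 (x i)

namespace FinPres

variable {N : ℕ} {P : Finset (Fin (N + 1))}

instance (p : FinPres N P) : CompactSpace p.X.core := p.compact

/-- The distances and the masses. -/
def data (p : FinPres N P) : (Fin (N + 1) → Fin (N + 1) → ℝ) × (Fin (N + 1) → ℝ≥0) :=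
  (fun i j => dist (p.x i) (p.x j), p.m)

theorem mem_support_iff (p : FinPres N P) {y : p.X} :
    y ∈ p.X.μ.support ↔ ∃ i ∈ P, p.x i = y := by
  constructor
  · have hF : (p.x '' P).Finite := P.finite_toSet.image _
    intro hy
    have hnull : p.X.μ (p.x '' P)ᶜ = 0 := by
      rw [p.measure _ hF.isClosed.measurableSet.compl]
      refine Finset.sum_eq_zero fun i _ => ?_
      by_cases hi : i ∈ P
      · simp [mem_image_of_mem p.x (Finset.mem_coe.2 hi)]
      · have := (p.pos i).not.2 hi
        rw [not_lt, nonpos_iff_eq_zero] at this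
        simp [this]
    obtain ⟨i, hi, rfl⟩ := Measure.support_subset_of_isClosed hF.isClosed
      (mem_ae_iff.2 hnull) hy
    exact ⟨i, hi, rfl⟩
  · rintro ⟨i, hi, rfl⟩
    refine MMSpace.mem_support_iff.2 fun ε hε => ?_
    rw [p.measure _ Metric.isOpen_ball.measurableSet]
    refine lt_of_lt_of_le ?_ (Finset.single_le_sum (fun _ _ => zero_le) (Finset.mem_univ i))
    simpa [hε] using (p.pos i).2 hi

/-- The cross distance that puts corresponding points at distance `η`. -/
def cross (p q : FinPres N P) (η : ℝ) (x : p.X) (y : q.X) : ℝ :=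
  ⨅ i, dist x (p.x i) + η + dist (q.x i) y

theorem cross_le (p q : FinPres N P) (η : ℝ) (x : p.X) (y : q.X) (i : Fin (N + 1)) :
    p.cross q η x y ≤ dist x (p.x i) + η + dist (q.x i) y :=
  ciInf_le (Finite.bddBelow_range _) i

theorem exists_cross_eq (p q : FinPres N P) (η : ℝ) (x : p.X) (y : q.X) :
    ∃ i, dist x (p.x i) + η + dist (q.x i) y = p.cross q η x y :=
  exists_eq_ciInf_of_finite

/-- A path that crosses to the other space and back pays `η` twice, which covers the distortion `η`
between corresponding points. -/
theorem isCoupling_cross {p q : FinPres N P} {η : ℝ} (hη : 0 ≤ η)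
    (h : ∀ i j, |dist (p.x i) (p.x j) - dist (q.x i) (q.x j)| ≤ η) :
    IsCoupling (p.cross q η) where
  left x x' y := by
    obtain ⟨i, hi⟩ := p.exists_cross_eq q η x' y
    linarith [p.cross_le q η x y i, dist_triangle x x' (p.x i)]
  right x y y' := by
    obtain ⟨i, hi⟩ := p.exists_cross_eq q η x y'
    linarith [p.cross_le q η x y i, dist_triangle (q.x i) y' y]
  left_le x x' y := by
    obtain ⟨i, hi⟩ := p.exists_cross_eq q η x y
    obtain ⟨j, hj⟩ := p.exists_cross_eq q η x' y
    linarith [dist_triangle4 x (p.x i) (p.x j) x', dist_comm (p.x j) x', (abs_le.1 (h i j)).2,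
      dist_triangle_right (q.x i) (q.x j) y]
  right_le x y y' := by
    obtain ⟨i, hi⟩ := p.exists_cross_eq q η x y
    obtain ⟨j, hj⟩ := p.exists_cross_eq q η x y'
    linarith [dist_triangle4 y (q.x i) (q.x j) y', dist_comm y (q.x i), (abs_le.1 (h i j)).1,
      dist_triangle_left (p.x i) (p.x j) x]

theorem cross_self_le (p q : FinPres N P) (η : ℝ) (i : Fin (N + 1)) :
    p.cross q η (p.x i) (q.x i) ≤ η := by
  simpa using p.cross_le q η (p.x i) (q.x i) i

theorem LPLe_cross {p q : FinPres N P} {d : p.X → q.X → ℝ} (hd : IsCoupling d) {η ε : ℝ}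
    (hη : η < ε) (h : ∀ i, d (p.x i) (q.x i) ≤ η) (hm : ∑ i, |(p.m i : ℝ) - q.m i| ≤ ε) :
    LPLe d p.X.μ q.X.μ ε := by
  intro A hA
  rw [p.measure A hA, q.measure _ (hd.isOpen_left A ε).measurableSet]
  have h1 : ∀ i, (p.m i : ℝ≥0∞) * A.indicator 1 (p.x i) ≤
      q.m i * {y | ∃ x ∈ A, d x y < ε}.indicator 1 (q.x i) +
        ENNReal.ofReal |(p.m i : ℝ) - q.m i| := fun i => by
    by_cases hi : p.x i ∈ A
    · have hi' : q.x i ∈ {y | ∃ x ∈ A, d x y < ε} := ⟨_, hi, (h i).trans_lt hη⟩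
      rw [indicator_of_mem hi, indicator_of_mem hi', Pi.one_apply, Pi.one_apply, mul_one, mul_one,
        ← ENNReal.ofReal_coe_nnreal, ← ENNReal.ofReal_coe_nnreal, ← ENNReal.ofReal_add
        (NNReal.coe_nonneg _) (abs_nonneg _)]
      exact ENNReal.ofReal_le_ofReal (by linarith [le_abs_self ((p.m i : ℝ) - q.m i)])
    · simp [hi]
  refine (Finset.sum_le_sum fun i _ => h1 i).trans ?_
  rw [Finset.sum_add_distrib, ← ENNReal.ofReal_sum_of_nonneg fun i _ => abs_nonneg _]
  exact add_le_add le_rfl (ENNReal.ofReal_le_ofReal hm)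

theorem sClose_cross {p q : FinPres N P} {η ε : ℝ} (hη : 0 ≤ η) (hε : η < ε)
    (h : ∀ i j, |dist (p.x i) (p.x j) - dist (q.x i) (q.x j)| ≤ η)
    (hm : ∑ i, |(p.m i : ℝ) - q.m i| ≤ ε) : SClose p.X q.X (p.cross q η) ε where
  coupling := isCoupling_cross hη h
  root := by
    rw [← p.root, ← q.root]
    exact (p.cross_self_le q η 0).trans_lt hε
  left y hy := by
    obtain ⟨i, hi, rfl⟩ := p.mem_support_iff.1 hy
    exact ⟨_, q.mem_support_iff.2 ⟨i, hi, rfl⟩, (p.cross_self_le q η i).trans_lt hε⟩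
  right y hy := by
    obtain ⟨i, hi, rfl⟩ := q.mem_support_iff.1 hy
    exact ⟨_, p.mem_support_iff.2 ⟨i, hi, rfl⟩, (p.cross_self_le q η i).trans_lt hε⟩
  lp := LPLe_cross (isCoupling_cross hη h) hε (p.cross_self_le q η) hm
  lp' := LPLe_cross (isCoupling_cross hη h).flip hε (p.cross_self_le q η)
    (by simpa only [abs_sub_comm] using hm)

/-- With `P` fixed the supports have the same indices, so no atom disappears in the limit. -/
theorem tendsto_sGHPEDist {p : ℕ → FinPres N P} {p₀ : FinPres N P}
    (h : Tendsto (fun k => (p k).data) atTop (𝓝 p₀.data)) :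
    Tendsto (fun k => sGHPEDist (p k).X p₀.X) atTop (𝓝 0) := by
  refine SupportGHP.tendsto_sGHPEDist
    (fun δ hδ => by rw [← lowerMass_core]; exact lowerMass_pos _ hδ) fun ε hε => ?_
  have h1 : ∀ i j, Tendsto (fun k => |dist ((p k).x i) ((p k).x j) - dist (p₀.x i) (p₀.x j)|)
      atTop (𝓝 0) := fun i j => by
    have := tendsto_pi_nhds.1 (tendsto_pi_nhds.1 ((continuous_fst.tendsto _).comp h) i) j
    simpa [data] using (this.sub_const (dist (p₀.x i) (p₀.x j))).abs
  have h2 : Tendsto (fun k => ∑ i, |((p k).m i : ℝ) - p₀.m i|) atTop (𝓝 0) := by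
    have h3 : ∀ i, Tendsto (fun k => |((p k).m i : ℝ) - p₀.m i|) atTop (𝓝 0) := fun i => by
      have := (NNReal.continuous_coe.tendsto _).comp
        (tendsto_pi_nhds.1 ((continuous_snd.tendsto _).comp h) i)
      simpa [data] using (this.sub_const (p₀.m i : ℝ)).abs
    simpa using tendsto_finsetSum Finset.univ fun i _ => h3 i
  filter_upwards [eventually_all.2 fun i => eventually_all.2 fun j =>
    (h1 i j).eventually (gt_mem_nhds (half_pos hε)), h2.eventually (gt_mem_nhds hε)] with k hk hk2
  exact ⟨_, sClose_cross (half_pos hε).le (half_lt_self hε) (fun i j => (hk i j).le) hk2.le⟩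

end FinPres

/-- Each point sends its mass to a nearest point of a finite net, hence by less than `r`. -/
theorem exists_finPres_sClose (X : MMSpace) [CompactSpace X] {ε : ℝ} (hε : 0 < ε) :
    ∃ (N : ℕ) (P : Finset (Fin (N + 1))) (p : FinPres N P) (d : p.X → X → ℝ),
      SClose p.X X d ε := by
  classical
  have := X.isFiniteMeasure
  obtain ⟨r, hr⟩ : ∃ r, r = ε / 2 := ⟨_, rfl⟩
  have hr0 : 0 < r := by linarith
  -- Index 0 is reserved for the root.
  let e : ℕ → X := fun n => n.casesOn X.root (TopologicalSpace.denseSeq X)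
  have he : ∀ x : X, ∃ i, dist x (e i) < r := fun x => by
    obtain ⟨n, hn⟩ := (TopologicalSpace.denseRange_denseSeq X).exists_dist_lt x hr0
    exact ⟨n + 1, hn⟩
  obtain ⟨t, ht⟩ := (isCompact_univ (X := X)).elim_finite_subcover (fun i => Metric.ball (e i) r)
    (fun i => Metric.isOpen_ball) fun x _ => mem_iUnion.2 (he x)
  let N := t.sup id
  let ind := SimpleFunc.nearestPtInd e N
  have hind : ∀ x, ind x ≤ N := SimpleFunc.nearestPtInd_le e N
  let π : X → X := fun x => e (ind x)
  have hπ : ∀ x, dist (π x) x < r := fun x => by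
    obtain ⟨i, hi, hx⟩ := mem_iUnion₂.1 (ht (mem_univ x))
    have h1 : edist (π x) x ≤ edist (e i) x :=
      SimpleFunc.edist_nearestPt_le e x (Finset.le_sup (f := id) hi)
    rw [edist_dist, edist_dist, ENNReal.ofReal_le_ofReal_iff dist_nonneg] at h1
    rw [Metric.mem_ball, dist_comm] at hx
    exact h1.trans_lt hx
  have hπm : Measurable π := (SimpleFunc.measurable (SimpleFunc.nearestPt e N))
  let Y : MMSpace :=
    { carrier := X
      root := X.root
      μ := X.μ.map π
      finite_of_isBounded := fun s _ => measure_lt_top _ _ }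
  have hYc : CompactSpace Y := ‹CompactSpace X›
  have hY : ∀ A : Set X, MeasurableSet A → Y.μ A = X.μ (π ⁻¹' A) := fun A hA =>
    Measure.map_apply hπm hA
  let m : Fin (N + 1) → ℝ≥0 := fun i => (X.μ (ind ⁻¹' {(i : ℕ)})).toNNReal
  have hm : ∀ i, (m i : ℝ≥0∞) = X.μ (ind ⁻¹' {(i : ℕ)}) := fun i =>
    ENNReal.coe_toNNReal (measure_ne_top _ _)
  let p : FinPres N (Finset.univ.filter fun i => 0 < m i) :=
    { X := Y
      compact := inferInstance
      x := fun i => e i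
      m := m
      root := rfl
      pos := fun i => by simp
      measure := fun A hA => by
        have h1 : π ⁻¹' A = ind ⁻¹' ((Finset.range (N + 1)).filter fun i => e i ∈ A) := by
          ext x
          simp [π, hind x]
        rw [hY A hA, h1, ← sum_measure_preimage_singleton _
          fun y _ => ind.measurableSet_preimage _, Finset.sum_filter, Finset.sum_range]
        refine Finset.sum_congr rfl fun i _ => ?_
        rw [hm]
        by_cases hi : e i ∈ A <;> simp [hi] }
  have hlp : LPLe (fun x y : X => dist x y) Y.μ X.μ r := fun A hA => by
    rw [hY A hA]
    exact le_add_right (measure_mono fun x hx => ⟨π x, hx, hπ x⟩)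
  have hlp' : LPLe (fun y x : X => dist x y) X.μ Y.μ r := fun A hA => by
    rw [hY _ (IsCoupling.dist_self.flip.isOpen_left A r).measurableSet]
    exact le_add_right (measure_mono fun x hx => ⟨x, hx, hπ x⟩)
  refine ⟨N, _, p, fun x y : X => dist x y, IsCoupling.dist_self, ?_, fun y hy => ?_,
    fun x hx => ?_, hlp.mono (by linarith), hlp'.mono (by linarith)⟩
  · exact (dist_self X.root).trans_lt hε
  · obtain ⟨i, hi, rfl⟩ := p.mem_support_iff.1 hy
    have hpos : 0 < X.μ (ind ⁻¹' {(i : ℕ)}) := by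
      rw [← hm]
      exact_mod_cast (p.pos i).2 hi
    obtain ⟨x, hxi, hx⟩ := Measure.nonempty_inter_support_of_pos hpos
    refine ⟨x, hx, ?_⟩
    have h1 : π x = e i := congrArg e hxi
    have h2 := hπ x
    rw [h1] at h2
    exact h2.trans (by linarith)
  -- The mass in the `r`-ball around `x` moves by less than `r`, so it stays within `2 * r`.
  · have h1 : 0 < Y.μ (Metric.ball x (2 * r)) := by
      rw [hY _ Metric.isOpen_ball.measurableSet]
      refine (MMSpace.mem_support_iff.1 hx r hr0).trans_le (measure_mono fun z hz => ?_)
      rw [Metric.mem_ball] at hz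
      rw [mem_preimage, Metric.mem_ball]
      linarith [dist_triangle (π z) z x, hπ z]
    obtain ⟨y, hy, hys⟩ := Measure.nonempty_inter_support_of_pos (X := Y) h1
    refine ⟨y, hys, ?_⟩
    exact (show dist y x < 2 * r from hy).trans_le (by linarith)


/-! ### The metric on classes of compact spaces -/

/-- A compact representative. -/
def CompactMM.rep (x : CompactMM) : MMSpace := x.2.choose

theorem CompactMM.mk_rep (x : CompactMM) : MMClass.mk x.rep = x.1 := x.2.choose_spec.1

instance (x : CompactMM) : CompactSpace x.rep := x.2.choose_spec.2

theorem mmClass_mk_eq_iff {X Y : MMSpace} :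
    MMClass.mk X = MMClass.mk Y ↔ StrongEquiv X.core Y.core :=
  Quotient.eq (r := mmSetoid)

theorem MMSpace.isCompact_mk (X : MMSpace) [CompactSpace X] : (MMClass.mk X).IsCompact :=
  ⟨X, rfl, inferInstance⟩

theorem CompactMM.mk_rep_eq (x : CompactMM) : CompactMM.mk x.rep x.rep.isCompact_mk = x :=
  Subtype.ext x.mk_rep

/-- The support Gromov-Hausdorff-Prohorov metric. -/
@[reducible]
def compactMMMetric : MetricSpace CompactMM :=
  let E : EMetricSpace CompactMM :=
    { edist x y := sGHPEDist x.rep y.rep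
      edist_self x := sGHPEDist_eq_zero_iff.2 (strongEquiv_equivalence.refl _)
      edist_comm x y := sGHPEDist_comm _ _
      edist_triangle x y z := sGHPEDist_triangle _ _ _
      eq_of_edist_eq_zero := fun {x y} h => Subtype.ext (by
        rw [← x.mk_rep, ← y.mk_rep]
        exact mmClass_mk_eq_iff.2 (sGHPEDist_eq_zero_iff.1 h)) }
  EMetricSpace.toMetricSpace fun x y => (sGHPEDist_lt_top x.rep y.rep).ne

section CompactMM

attribute [local instance] compactMMMetric

theorem compactMM_edist_mk (X Y : MMSpace) (hX : (MMClass.mk X).IsCompact)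
    (hY : (MMClass.mk Y).IsCompact) :
    edist (CompactMM.mk X hX) (CompactMM.mk Y hY) = sGHPEDist X Y :=
  sGHPEDist_congr (mmClass_mk_eq_iff.1 (CompactMM.mk X hX).mk_rep)
    (mmClass_mk_eq_iff.1 (CompactMM.mk Y hY).mk_rep)

theorem compactMM_tendsto_mk_iff {X : ℕ → MMSpace} {X₀ : MMSpace}
    (hX : ∀ n, (MMClass.mk (X n)).IsCompact) (hX₀ : (MMClass.mk X₀).IsCompact) :
    Tendsto (fun n => CompactMM.mk (X n) (hX n)) atTop (𝓝 (CompactMM.mk X₀ hX₀)) ↔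
      Tendsto (fun n => sGHPEDist (X n) X₀) atTop (𝓝 0) := by
  rw [tendsto_iff_edist_tendsto_0]
  simp only [compactMM_edist_mk]

theorem compactMM_tendsto_iff_ghwConverges {X : ℕ → MMSpace} {X₀ : MMSpace}
    (hX : ∀ n, (MMClass.mk (X n)).IsCompact) (hX₀ : (MMClass.mk X₀).IsCompact) :
    Tendsto (fun n => CompactMM.mk (X n) (hX n)) atTop (𝓝 (CompactMM.mk X₀ hX₀)) ↔
      GHWConverges X X₀ := by
  have := fun n => mmClass_isCompact_iff.1 (hX n)
  have := mmClass_isCompact_iff.1 hX₀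
  rw [compactMM_tendsto_mk_iff, ghwConverges_iff]

/-- Both topologies have the same test sequences, and in a metric space sequentially closed sets are
closed. -/
theorem compactMM_topology_eq :
    (UniformSpace.toTopologicalSpace : TopologicalSpace CompactMM) = ghwTopology := by
  refine TopologicalSpace.ext_iff.2 fun U => ⟨fun hU X X₀ hX hX₀ h hmem => ?_, fun hU => ?_⟩
  · exact ((compactMM_tendsto_iff_ghwConverges hX hX₀).2 h).eventually (hU.mem_nhds hmem)
  · rw [← isClosed_compl_iff]
    refine IsSeqClosed.isClosed fun x x₀ hx hlim hmem => ?_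
    have h : Tendsto (fun n => CompactMM.mk (x n).rep (x n).rep.isCompact_mk) atTop
        (𝓝 (CompactMM.mk x₀.rep x₀.rep.isCompact_mk)) := by
      simpa only [CompactMM.mk_rep_eq] using hlim
    have h' := hU (fun n => (x n).rep) x₀.rep (fun n => (x n).rep.isCompact_mk)
      x₀.rep.isCompact_mk ((compactMM_tendsto_iff_ghwConverges _ _).1 h)
      (by rwa [CompactMM.mk_rep_eq])
    obtain ⟨n, hn⟩ := h'.exists
    rw [CompactMM.mk_rep_eq] at hn
    exact hx n hn

theorem compactMM_completeSpace : CompleteSpace CompactMM := by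
  refine Metric.complete_of_convergent_controlled_sequences (fun n => (1 / 2 : ℝ) ^ n)
    (fun n => by positivity) fun u hu => ?_
  have hlt : ∀ N n m, N ≤ n → N ≤ m →
      sGHPEDist (u n).rep (u m).rep < ENNReal.ofReal ((1 / 2) ^ N) := fun N n m hn hm => by
    have := hu N n m hn hm
    rwa [← ENNReal.ofReal_lt_ofReal_iff (by positivity), ← edist_dist] at this
  obtain ⟨Y, _, hY⟩ := exists_limit (C := fun n => (u n).rep.core)
    (fun N n m hn hm => le_self_add.trans_lt (hlt N n m hn hm))
    (fun N n m hn hm => by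
      rw [lowerMassEDist_core]
      exact le_add_self.trans_lt (hlt N n m hn hm))
  -- Only a subsequence is seen to converge; the Cauchy property extends this to the whole sequence.
  choose k hk d hd using fun j : ℕ => hY (1 / ((j : ℝ) + 1)) Nat.one_div_pos_of_nat j
  have hlim : Tendsto (fun j => sGHPEDist (u (k j)).rep.core Y) atTop (𝓝 0) := by
    refine tendsto_sGHPEDist (fun δ hδ => lowerMass_pos Y hδ) fun ε hε => ?_
    filter_upwards [tendsto_one_div_add_atTop_nhds_zero_nat.eventually (gt_mem_nhds hε)] with j hj
    exact ⟨d j, (hd j).mono hj.le⟩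
  refine ⟨CompactMM.mk Y Y.isCompact_mk, tendsto_nhds_of_cauchySeq_of_subseq
    (u := u) ?_ (tendsto_atTop_mono hk tendsto_id) ?_⟩
  · refine Metric.cauchySeq_iff.2 fun ε hε => ?_
    obtain ⟨N, hN⟩ := exists_pow_lt_of_lt_one hε one_half_lt_one
    exact ⟨N, fun m hm n hn => (hu N m n hm hn).trans hN⟩
  · have := (compactMM_tendsto_mk_iff (fun j => (u (k j)).rep.core.isCompact_mk)
      Y.isCompact_mk).2 hlim
    refine this.congr fun j => Subtype.ext ?_
    exact (mmClass_mk_core _).trans (u (k j)).mk_rep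

/-- The topology induced by `data` is second countable, and the class depends continuously on it. -/
theorem FinPres.isSeparable_range {N : ℕ} {P : Finset (Fin (N + 1))} :
    TopologicalSpace.IsSeparable (range fun p : FinPres N P =>
      CompactMM.mk p.X (mmClass_isCompact_iff.2 p.compact)) := by
  let _ : TopologicalSpace (FinPres N P) := TopologicalSpace.induced FinPres.data inferInstance
  have : SecondCountableTopology (FinPres N P) :=
    TopologicalSpace.secondCountableTopology_induced _ _ FinPres.data
  refine TopologicalSpace.isSeparable_range (SeqContinuous.continuous fun p p₀ hp => ?_)
  refine (compactMM_tendsto_mk_iff (X := fun k => (p k).X) _ _).2 (FinPres.tendsto_sGHPEDist ?_)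
  exact (continuous_induced_dom.tendsto p₀).comp hp

theorem compactMM_separableSpace : TopologicalSpace.SeparableSpace CompactMM := by
  have hS : TopologicalSpace.IsSeparable (⋃ (N : ℕ) (P : Finset (Fin (N + 1))),
      range fun p : FinPres N P => CompactMM.mk p.X (mmClass_isCompact_iff.2 p.compact)) :=
    .iUnion fun N => .iUnion fun P => FinPres.isSeparable_range
  rw [← TopologicalSpace.isSeparable_univ_iff]
  refine hS.closure.mono fun x _ => ?_
  choose N P p d hd using fun k : ℕ =>
    exists_finPres_sClose x.rep (Nat.one_div_pos_of_nat (α := ℝ) (n := k))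
  have hlim : Tendsto (fun k => sGHPEDist (p k).X x.rep) atTop (𝓝 0) := by
    refine tendsto_sGHPEDist (fun δ hδ => lowerMass_pos _ hδ) fun ε hε => ?_
    filter_upwards [tendsto_one_div_add_atTop_nhds_zero_nat.eventually (gt_mem_nhds hε)] with j hj
    exact ⟨d j, (hd j).mono hj.le⟩
  rw [← x.mk_rep_eq]
  refine mem_closure_of_tendsto ((compactMM_tendsto_mk_iff (fun k =>
    mmClass_isCompact_iff.2 (p k).compact) x.rep.isCompact_mk).2 hlim) ?_
  exact Eventually.of_forall fun k => mem_iUnion₂.2 ⟨N k, P k, p k, rfl⟩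

/-- The approximating root is a support point, so it is close both to the limit root and to some
point of the limit support. -/
theorem compactMM_isClosed_root_mem_support : IsClosed {x : CompactMM |
    ∃ X : MMSpace, MMClass.mk X = x.1 ∧ X.root ∈ X.μ.support} := by
  refine IsSeqClosed.isClosed fun x x₀ hx hlim => ?_
  choose X hX hroot using hx
  refine ⟨x₀.rep, x₀.mk_rep, ?_⟩
  have hXc : ∀ n, (MMClass.mk (X n)).IsCompact := fun n => hX n ▸ (x n).2
  have := fun n => mmClass_isCompact_iff.1 (hXc n)
  have h1 : Tendsto (fun n => CompactMM.mk (X n) (hXc n)) atTop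
      (𝓝 (CompactMM.mk x₀.rep x₀.rep.isCompact_mk)) := by
    rw [x₀.mk_rep_eq]
    exact hlim.congr fun n => Subtype.ext (hX n).symm
  have h2 := tendsto_sGHPEDist_iff.1 ((compactMM_tendsto_mk_iff _ _).1 h1)
  have h3 : x₀.rep.core.root ∈ closure x₀.rep.core.μ.support := by
    refine Metric.mem_closure_iff.2 fun ε hε => ?_
    obtain ⟨n, d, hd⟩ := (h2 (ε / 2) (by linarith)).exists
    have h4 : (X n).core.root ∈ (X n).core.μ.support := by
      rw [MMSpace.core_support]
      exact hroot n
    obtain ⟨y, hy, hxy⟩ := hd.left _ h4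
    exact ⟨y, hy, by linarith [hd.coupling.right_le (X n).core.root x₀.rep.core.root y, hd.root]⟩
  rw [Measure.isClosed_support.closure_eq, MMSpace.core_support] at h3
  exact h3

end CompactMM

/-! ### The metric on strong classes of compact spaces with full support -/

/-- A compact representative with full support. -/
def CompactFullSupport.rep (x : CompactFullSupport) : MMSpace := x.2.choose

theorem CompactFullSupport.mk_rep (x : CompactFullSupport) : StrongClass.mk x.rep = x.1 :=
  x.2.choose_spec.1

instance (x : CompactFullSupport) : CompactSpace x.rep := x.2.choose_spec.2.1

theorem CompactFullSupport.support_rep (x : CompactFullSupport) : x.rep.μ.support = univ :=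
  x.2.choose_spec.2.2

theorem strongClass_mk_eq_iff {X Y : MMSpace} :
    StrongClass.mk X = StrongClass.mk Y ↔ StrongEquiv X Y :=
  Quotient.eq (r := strongSetoid)

theorem CompactFullSupport.isCompactFullSupport_rep (x : CompactFullSupport) :
    (StrongClass.mk x.rep).IsCompactFullSupport :=
  ⟨x.rep, rfl, inferInstance, x.support_rep⟩

theorem CompactFullSupport.mk_rep_eq (x : CompactFullSupport) :
    CompactFullSupport.mk x.rep x.isCompactFullSupport_rep = x :=
  Subtype.ext x.mk_rep

theorem CompactFullSupport.strongEquiv_core_rep (x : CompactFullSupport) :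
    StrongEquiv x.rep.core x.rep :=
  strongEquiv_core (by rw [MMSpace.coreSet, x.support_rep, univ_union])

/-- The Gromov-Hausdorff-Prohorov metric. -/
@[reducible]
def compactFullSupportMetric : MetricSpace CompactFullSupport :=
  let E : EMetricSpace CompactFullSupport :=
    { edist x y := ghpEDist x.rep y.rep
      edist_self x := (strongEquiv_equivalence.refl x.rep).ghpEDist_eq_zero
      edist_comm x y := ghpEDist_comm _ _
      edist_triangle x y z := ghpEDist_triangle _ _ _
      eq_of_edist_eq_zero := fun {x y} h => Subtype.ext (by
        rw [← x.mk_rep, ← y.mk_rep]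
        exact strongClass_mk_eq_iff.2 (strongEquiv_of_ghpEDist_eq_zero h)) }
  EMetricSpace.toMetricSpace fun x y => (ghpEDist_lt_top x.rep y.rep).ne

/-- The inclusion of the strong classes with full support into all classes. -/
def CompactFullSupport.toCompactMM (x : CompactFullSupport) : CompactMM :=
  CompactMM.mk x.rep x.rep.isCompact_mk

theorem range_toCompactMM : range CompactFullSupport.toCompactMM = {x : CompactMM |
    ∃ X : MMSpace, MMClass.mk X = x.1 ∧ X.root ∈ X.μ.support} := by
  ext x
  constructor
  · rintro ⟨y, rfl⟩
    exact ⟨y.rep, rfl, y.support_rep ▸ mem_univ _⟩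
  · rintro ⟨X, hX, hroot⟩
    have hc : CompactSpace X.core := mmClass_isCompact_iff.1 (hX ▸ x.2)
    have hs : X.core.μ.support = univ := eq_univ_of_forall fun z => by
      rcases MMSpace.mem_support_or_eq_root z with h | rfl
      · exact h
      · rw [MMSpace.core_support]
        exact hroot
    let y : CompactFullSupport := CompactFullSupport.mk X.core ⟨X.core, rfl, hc, hs⟩
    refine ⟨y, Subtype.ext ?_⟩
    have h1 : StrongEquiv y.rep X.core := strongClass_mk_eq_iff.1 y.mk_rep
    exact (mmClass_mk_eq_iff.2 (strongEquiv_equivalence.trans y.strongEquiv_core_rep h1)).trans hX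

section CompactFullSupport

attribute [local instance] compactMMMetric compactFullSupportMetric

theorem compactFullSupport_edist_mk (X Y : MMSpace) (hX : (StrongClass.mk X).IsCompactFullSupport)
    (hY : (StrongClass.mk Y).IsCompactFullSupport) :
    edist (CompactFullSupport.mk X hX) (CompactFullSupport.mk Y hY) = ghpEDist X Y :=
  ghpEDist_congr (strongClass_mk_eq_iff.1 (CompactFullSupport.mk X hX).mk_rep)
    (strongClass_mk_eq_iff.1 (CompactFullSupport.mk Y hY).mk_rep)

theorem edist_le_edist_toCompactMM (x y : CompactFullSupport) :
    edist x y ≤ edist x.toCompactMM y.toCompactMM := by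
  rw [CompactFullSupport.toCompactMM, CompactFullSupport.toCompactMM, compactMM_edist_mk,
    sGHPEDist_eq, ghpEDist_congr x.strongEquiv_core_rep y.strongEquiv_core_rep]
  exact le_self_add

/-- With full supports the Hausdorff bound for the spaces is one for the supports, so a witness
already is an `SClose`. -/
theorem continuous_toCompactMM : Continuous CompactFullSupport.toCompactMM := by
  refine SeqContinuous.continuous fun x x₀ hx => ?_
  refine (compactMM_tendsto_mk_iff (X := fun n => (x n).rep) _ _).2
    (tendsto_sGHPEDist (fun δ hδ => lowerMass_pos _ hδ) fun ε hε => ?_)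
  have h1 : Tendsto (fun n => ghpEDist (x n).rep x₀.rep) atTop (𝓝 0) :=
    tendsto_iff_edist_tendsto_0.1 hx
  filter_upwards [h1.eventually (gt_mem_nhds (ENNReal.ofReal_pos.2 hε))] with n hn
  obtain ⟨d, a, b, c, h, hlt⟩ := exists_ghpWitness_of_lt hn
  have ha := h.pos
  have hb : 0 < b := by
    obtain ⟨y, hy⟩ := h.left (x n).rep.root
    exact (h.coupling.nonneg _ _).trans_lt hy
  have hc : 0 < c := (h.coupling.nonneg _ _).trans_lt h.root
  refine ⟨d, h.coupling, by linarith [h.root], fun z _ => ?_, fun z _ => ?_,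
    h.lp.mono (by linarith), h.lp'.mono (by linarith)⟩
  · obtain ⟨y, hy⟩ := h.left z
    exact ⟨y, x₀.support_rep ▸ mem_univ y, by linarith⟩
  · obtain ⟨y, hy⟩ := h.right z
    exact ⟨y, (x n).support_rep ▸ mem_univ y, by linarith⟩

/-- The inverse is continuous because the support distance dominates. The metrics induce the same
topology but not the same Cauchy sequences. -/
theorem isClosedEmbedding_toCompactMM : IsClosedEmbedding CompactFullSupport.toCompactMM := by
  refine ⟨⟨isInducing_iff_nhds.2 fun x => le_antisymm
    (continuous_toCompactMM.tendsto x).le_comap ?_, fun x y hxy => ?_⟩, ?_⟩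
  · rw [← tendsto_id', tendsto_iff_edist_tendsto_0]
    exact tendsto_of_tendsto_of_tendsto_of_le_of_le tendsto_const_nhds
      (tendsto_iff_edist_tendsto_0.1 tendsto_comap) (fun _ => zero_le)
      fun y => edist_le_edist_toCompactMM y x
  · rw [← edist_le_zero]
    exact (edist_le_edist_toCompactMM x y).trans_eq (by rw [hxy, edist_self])
  · rw [range_toCompactMM]
    exact compactMM_isClosed_root_mem_support

theorem compactFullSupport_polishSpace : PolishSpace CompactFullSupport := by
  have := compactMM_completeSpace
  have := compactMM_separableSpace
  have : SecondCountableTopology CompactMM := UniformSpace.secondCountable_of_separable CompactMM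
  exact isClosedEmbedding_toCompactMM.polishSpace

end CompactFullSupport

/-! ### Failure of completeness -/

/-- Two points at distance one, the root with mass one and the other one with mass `c`. -/
def twoPoint (c : ℝ≥0) : MMSpace :=
  have : CompactSpace ({0, 1} : Set ℝ) :=
    isCompact_iff_compactSpace.1 (Set.toFinite ({0, 1} : Set ℝ)).isCompact
  { carrier := ({0, 1} : Set ℝ)
    root := ⟨0, by simp⟩
    μ := Measure.dirac ⟨0, by simp⟩ + (c : ℝ≥0∞) • Measure.dirac ⟨1, by simp⟩
    finite_of_isBounded := fun s _ => by
      refine (measure_mono (subset_univ s)).trans_lt ?_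
      simp }

namespace twoPoint

variable (c : ℝ≥0)

/-- The second point. -/
def other : twoPoint c := (⟨1, by simp⟩ : ({0, 1} : Set ℝ))

instance : CompactSpace (twoPoint c) :=
  isCompact_iff_compactSpace.1 (Set.toFinite ({0, 1} : Set ℝ)).isCompact

theorem μ_eq : (twoPoint c).μ =
    Measure.dirac (twoPoint c).root + (c : ℝ≥0∞) • Measure.dirac (other c) := rfl

theorem eq_root_or_eq_other (x : twoPoint c) : x = (twoPoint c).root ∨ x = other c := by
  obtain ⟨x, rfl | rfl⟩ := x
  · exact Or.inl rfl
  · exact Or.inr rfl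

theorem dist_root_other : dist (twoPoint c).root (other c) = 1 := by
  change dist (0 : ℝ) 1 = 1
  simp

theorem support_eq_univ (hc : 0 < c) : (twoPoint c).μ.support = univ := by
  refine eq_univ_of_forall fun x => MMSpace.mem_support_iff.2 fun ε hε => ?_
  rw [μ_eq, Measure.add_apply, Measure.smul_apply]
  rcases eq_root_or_eq_other c x with rfl | rfl
  · simp [hε]
  · refine lt_of_lt_of_le ?_ le_add_self
    simpa [hε] using hc

theorem other_notMem_support : other 0 ∉ (twoPoint 0).μ.support := fun h => by
  have h1 := MMSpace.mem_support_iff.1 h 1 one_pos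
  rw [μ_eq, ENNReal.coe_zero, zero_smul, add_zero,
    Measure.dirac_apply' _ Metric.isOpen_ball.measurableSet, indicator_of_notMem] at h1
  · exact lt_irrefl _ h1
  · rw [Metric.mem_ball, dist_root_other]
    exact lt_irrefl _

theorem ghpEDist_zero_lt {c : ℝ≥0} {a : ℝ} (ha : c < a) :
    ghpEDist (twoPoint c) (twoPoint 0) < ENNReal.ofReal (4 * a) := by
  have ha0 : 0 < a := c.2.trans_lt ha
  have hself : ∀ x : ({0, 1} : Set ℝ), dist x x < a := fun x => by rwa [dist_self]
  have happly : ∀ (c : ℝ≥0) (A : Set ({0, 1} : Set ℝ)), (twoPoint c).μ A =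
      Measure.dirac (⟨0, by simp⟩ : ({0, 1} : Set ℝ)) A +
        c * Measure.dirac (⟨1, by simp⟩ : ({0, 1} : Set ℝ)) A := fun c A => rfl
  have h0 : ∀ A : Set ({0, 1} : Set ℝ), (twoPoint 0).μ A ≤ (twoPoint c).μ A := fun A => by
    rw [happly, happly, ENNReal.coe_zero, zero_mul, add_zero]
    exact le_self_add
  have h1 : ∀ A : Set ({0, 1} : Set ℝ),
      (twoPoint c).μ A ≤ (twoPoint 0).μ A + ENNReal.ofReal a := fun A => by
    rw [happly, happly, ENNReal.coe_zero, zero_mul, add_zero]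
    refine add_le_add le_rfl ((mul_le_of_le_one_right' prob_le_one).trans ?_)
    rw [← ENNReal.ofReal_coe_nnreal]
    exact ENNReal.ofReal_le_ofReal ha.le
  refine GHPWitness.ghpEDist_lt (d := fun x y : ({0, 1} : Set ℝ) => dist x y)
    (a := a) (b := a) (c := a) ⟨IsCoupling.dist_self, ha0, fun A _ => ?_, fun A _ => ?_,
      fun x => ⟨x, hself x⟩, fun x => ⟨x, hself x⟩, hself _⟩ (by linarith)
  · exact (h1 A).trans (add_le_add (measure_mono fun x hx => ⟨x, hx, hself x⟩) le_rfl)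
  · exact (h0 A).trans (le_add_right (measure_mono fun x hx => ⟨x, hx, hself x⟩))

end twoPoint

theorem StrongEquiv.support_eq_univ {X Y : MMSpace} (h : StrongEquiv X Y)
    (hY : Y.μ.support = univ) : X.μ.support = univ := by
  obtain ⟨φ, -, hμ⟩ := h
  refine eq_univ_of_forall fun x => MMSpace.mem_support_iff.2 fun ε hε => ?_
  have h1 : φ x ∈ Y.μ.support := hY ▸ mem_univ _
  have h2 := MMSpace.mem_support_iff.1 h1 ε hε
  rwa [← hμ, Measure.map_apply φ.continuous.measurable Metric.isOpen_ball.measurableSet,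
    φ.isometry.preimage_ball] at h2

section CompactFullSupport

attribute [local instance] compactFullSupportMetric

/-- As the mass of the second point tends to zero, the limit keeps that point but loses it from the
support. A limit with full support would be strongly equivalent to `twoPoint 0`. -/
theorem compactFullSupport_not_completeSpace : ¬ CompleteSpace CompactFullSupport := by
  intro _
  let X : ℕ → MMSpace := fun n => twoPoint (1 / ((n : ℝ≥0) + 1))
  have hX : ∀ n, (StrongClass.mk (X n)).IsCompactFullSupport := fun n =>
    ⟨X n, rfl, inferInstanceAs (CompactSpace (twoPoint _)),
      twoPoint.support_eq_univ _ (by positivity)⟩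
  let u : ℕ → CompactFullSupport := fun n => CompactFullSupport.mk (X n) (hX n)
  have hv : Tendsto (fun n => ghpEDist (X n) (twoPoint 0)) atTop (𝓝 0) := by
    -- The factor 2 makes the Prohorov bound strictly larger than the mass `1 / (n + 1)`.
    have h1 : Tendsto (fun n : ℕ => ENNReal.ofReal (4 * (2 * (1 / ((n : ℝ) + 1))))) atTop
        (𝓝 0) := by
      simpa using ENNReal.tendsto_ofReal
        ((tendsto_one_div_add_atTop_nhds_zero_nat (𝕜 := ℝ)).const_mul 2 |>.const_mul 4)
    refine tendsto_of_tendsto_of_tendsto_of_le_of_le tendsto_const_nhds h1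
      (fun _ => zero_le) fun n => (twoPoint.ghpEDist_zero_lt ?_).le
    have : (0 : ℝ) < 1 / ((n : ℝ) + 1) := Nat.one_div_pos_of_nat
    push_cast
    linarith
  have hcauchy : CauchySeq u := by
    refine EMetric.cauchySeq_iff.2 fun ε hε => ?_
    obtain ⟨N, hN⟩ := eventually_atTop.1 (hv.eventually (gt_mem_nhds (ENNReal.half_pos hε.ne')))
    refine ⟨N, fun m hm n hn => ?_⟩
    rw [compactFullSupport_edist_mk]
    refine (ghpEDist_triangle _ (twoPoint 0) _).trans_lt ?_
    rw [ghpEDist_comm (twoPoint 0), ← ENNReal.add_halves ε]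
    exact ENNReal.add_lt_add (hN m hm) (hN n hn)
  obtain ⟨x, hx⟩ := cauchySeq_tendsto_of_complete hcauchy
  have hlim : Tendsto (fun n => ghpEDist (X n) x.rep) atTop (𝓝 0) := by
    rw [← x.mk_rep_eq] at hx
    refine (tendsto_iff_edist_tendsto_0.1 hx).congr fun n => ?_
    exact compactFullSupport_edist_mk _ _ _ _
  have hzero : ghpEDist (twoPoint 0) x.rep = 0 := by
    refine le_antisymm (ge_of_tendsto (by simpa using hv.add hlim)
      (Eventually.of_forall fun n => ?_)) bot_le
    refine (ghpEDist_triangle _ (X n) _).trans_eq ?_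
    rw [ghpEDist_comm (twoPoint 0)]
  exact twoPoint.other_notMem_support
    ((strongEquiv_of_ghpEDist_eq_zero hzero).support_eq_univ x.support_rep ▸ mem_univ _)

end CompactFullSupport

end SupportGHP

end

theorem mainTheorem7 :
    (∃ M : MetricSpace SupportGHP.CompactMM,
      (∀ (X Y : SupportGHP.MMSpace) (hX : (SupportGHP.MMClass.mk X).IsCompact)
        (hY : (SupportGHP.MMClass.mk Y).IsCompact),
        edist (SupportGHP.CompactMM.mk X hX) (SupportGHP.CompactMM.mk Y hY) =
          SupportGHP.sGHPEDist X Y) ∧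
      (UniformSpace.toTopologicalSpace : TopologicalSpace SupportGHP.CompactMM) =
        SupportGHP.ghwTopology ∧
      (∀ (X : ℕ → SupportGHP.MMSpace) (X₀ : SupportGHP.MMSpace)
        (hX : ∀ n, (SupportGHP.MMClass.mk (X n)).IsCompact)
        (hX₀ : (SupportGHP.MMClass.mk X₀).IsCompact),
        Filter.Tendsto (fun n => SupportGHP.CompactMM.mk (X n) (hX n)) Filter.atTop
          (nhds (SupportGHP.CompactMM.mk X₀ hX₀)) ↔ SupportGHP.GHWConverges X X₀) ∧
      CompleteSpace SupportGHP.CompactMM ∧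
      TopologicalSpace.SeparableSpace SupportGHP.CompactMM ∧
      IsClosed {x : SupportGHP.CompactMM |
        ∃ X : SupportGHP.MMSpace, SupportGHP.MMClass.mk X = x.1 ∧ X.root ∈ X.μ.support}) ∧
    (∃ M : MetricSpace SupportGHP.CompactFullSupport,
      (∀ (X Y : SupportGHP.MMSpace) (hX : (SupportGHP.StrongClass.mk X).IsCompactFullSupport)
        (hY : (SupportGHP.StrongClass.mk Y).IsCompactFullSupport),
        edist (SupportGHP.CompactFullSupport.mk X hX) (SupportGHP.CompactFullSupport.mk Y hY) =
          SupportGHP.ghpEDist X Y) ∧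
      PolishSpace SupportGHP.CompactFullSupport ∧
      ¬ CompleteSpace SupportGHP.CompactFullSupport) := by
  refine ⟨⟨SupportGHP.compactMMMetric, SupportGHP.compactMM_edist_mk,
    SupportGHP.compactMM_topology_eq, fun X X₀ hX hX₀ =>
      SupportGHP.compactMM_tendsto_iff_ghwConverges hX hX₀,
    SupportGHP.compactMM_completeSpace, SupportGHP.compactMM_separableSpace,
    SupportGHP.compactMM_isClosed_root_mem_support⟩,
    ⟨SupportGHP.compactFullSupportMetric, SupportGHP.compactFullSupport_edist_mk,
      SupportGHP.compactFullSupport_polishSpace,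
      SupportGHP.compactFullSupport_not_completeSpace⟩⟩
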